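/- Let $\ell\in\{\tfrac12,1,\tfrac32,2,\dots\}$ and $N=2\ell+1$; index rows and columns of $N\times N$ matrices by $0,1,\dots,2\ell$, and let $E_{i,j}$ be the matrix units ($E_{i,j}=0$ if an index lies outside $\{0,\dots,2\ell\}$). Let $U_r$ be the Chebyshev polynomials of the second kind (with $U_{-1}=0$, $U_{-r-2}=-U_r$) and $(a)_r=a(a+1)\cdots(a+r-1)$. Let $W$ be the symmetric $N\times N$ weight matrix on $[-1,1]$ with, for $n\le m$, $$W(x)_{n,m}=(1-x)^{\frac12}(1+x)^{\frac12}\,\frac{2\ell+1}{n+1}\,\frac{(2\ell-m)!\,m!}{(2\ell)!}\sum_{t=0}^{m}(-1)^{m-t}\frac{(n-2\ell)_{m-t}}{(n+2)_{m-t}}\,\frac{(2\ell+2-t)_t}{t!}\,U_{n+m-2t}(x),$$ and $W(x)_{n,m}=W(x)_{m,n}$ for $n>m$. For matrix polynomials $P,Q\in \mathrm{Mat}_N(\mathbb C)[x]$ put $\langle P,Q\rangle=\int_{-1}^1P(x)W(x)Q(x)^*\,dx$. A sequence $(R_n)_{n\ge0}$ is a sequence of orthogonal polynomials for $W$ if $R_n$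 has degree $n$ with nonsingular leading coefficient and $\langle R_n,R_m\rangle=0$ for $n\ne m$; let $(P_n)_{n\ge0}$ be the sequence of monic orthogonal polynomials. A differential operator $\mathcal O=\sum_i\partial^iF_i(x)$, $\partial=d/dx$, acts from the right by $P\mathcal O=\sum_iP^{(i)}(x)F_i(x)$. Define $$D=(x^2-1)\,\partial^2+\partial B_1(x)+B_0,\qquad E=\partial A_1(x)+A_0,$$ $$B_1(x)=\sum_{i=0}^{2\ell}\frac{(4\ell+3)(i-2\ell)}{2\ell}E_{i,i+1}-\sum_{i=0}^{2\ell}x\,\frac{(2\ell+3)(i-2\ell)}{\ell}E_{i,i}+\sum_{i=0}^{2\ell}\frac{3i}{2\ell}E_{i,i-1},$$ $$B_0=\sum_{i=0}^{2\ell}\frac{(i-2\ell)(i\ell-2\ell^2-5\ell-3)}{\ell}E_{i,i},$$ $$A_1(x)=\sum_{i=0}^{2\ell}\frac{2\ell-i}{2\ell}E_{i,i+1}-\sum_{i=0}^{2\ell}x\,\frac{\ell-i}{\ell}E_{i,i}-\sum_{i=0}^{2\ell}\frac{i}{2\ell}E_{i,i-1},\qquad A_0=\sum_{i=0}^{2\ell}\frac{(2\ell+2)(i-2\ell)}{2\ell}E_{i,i}.$$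 Then: 1. $D$ is symmetric with respect to $W$: its coefficients satisfy $\deg F_i\le i$, and $\langle PD,Q\rangle=\langle P,QD\rangle$ for all $P,Q\in\mathrm{Mat}_N(\mathbb C)[x]$. (Equivalently, $-D=(1-x^2)\partial^2-\partial B_1(x)-B_0$ is symmetric.) 2. Hence $D\in\mathcal D(W)$: for every sequence $(R_n)$ of orthogonal polynomials for $W$ there are matrices $\Gamma_n\in\mathrm{Mat}_N(\mathbb C)$ with $R_nD=\Gamma_nR_n$ for all $n\ge0$. 3. For every $n\ge0$, $P_nD=\Lambda_n(D)P_n$ with $$\Lambda_n(D)=\sum_{i=0}^{2\ell}\Big(n(n-1)-\frac{n(2\ell+3)(i-2\ell)}{\ell}+\frac{(i-2\ell)(i\ell-2\ell^2-5\ell-3)}{\ell}\Big)E_{i,i}.$$ 4. $D$ and $E$ commute: $(PD)E=(PE)D$ for all $P\in\mathrm{Mat}_N(\mathbb C)[x]$. -/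

import Mathlib

open Polynomial

noncomputable section

namespace MVOP

/-! Generalities: matrix valued polynomials, weights and right-hand side differential operators. -/

/-- The algebra of complex `N × N` matrices. -/
abbrev Mat (N : ℕ) : Type := Matrix (Fin N) (Fin N) ℂ

/-- Polynomials in a (central) indeterminate `x` with coefficients in the `N × N` matrices. -/
abbrev MatPoly (N : ℕ) : Type := (Mat N)[X]

/-- The value `P(x)` of a matrix valued polynomial at a real point `x`. -/
def evalAt {N : ℕ} (P : MatPoly N) (x : ℝ) : Mat N :=
  P.eval (algebraMap ℂ (Mat N) (x : ℂ))

/-- The matrix valued pairing `⟨P, Q⟩ = ∫_{-1}^{1} P(x) W(x) Q(x)^* dx` (integrated entrywise). -/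
def pairing {N : ℕ} (W : ℝ → Mat N) (P Q : MatPoly N) : Mat N :=
  Matrix.of fun i j =>
    ∫ x in (-1 : ℝ)..1, (evalAt P x * W x * (evalAt Q x).conjTranspose) i j

/-- A sequence of matrix valued orthogonal polynomials for `W`: `R n` has degree `n` with
nonsingular leading coefficient, and `⟨R n, R m⟩ = 0` for `n ≠ m`. -/
structure IsOrthogonalSeq {N : ℕ} (W : ℝ → Mat N) (R : ℕ → MatPoly N) : Prop where
  degree_eq : ∀ n, (R n).degree = n
  isUnit_leadingCoeff : ∀ n, IsUnit (R n).leadingCoeff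
  pairing_eq_zero : ∀ n m, n ≠ m → pairing W (R n) (R m) = 0

/-- A sequence of monic orthogonal polynomials for `W`. -/
structure IsMonicOrthogonalSeq {N : ℕ} (W : ℝ → Mat N) (P : ℕ → MatPoly N) : Prop
    extends IsOrthogonalSeq W P where
  monic : ∀ n, (P n).Monic

/-- A differential operator `∑ i, ∂^i F_i(x)` with matrix polynomial coefficients `F_i`,
given by its finitely many nonzero coefficients. -/
abbrev DiffOp (N : ℕ) : Type := ℕ →₀ MatPoly N

/-- The right-hand side action `P D = ∑ i, P^{(i)}(x) F_i(x)` (coefficients multiply from the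
right). -/
def act {N : ℕ} (P : MatPoly N) (D : DiffOp N) : MatPoly N :=
  D.sum fun i F => derivative^[i] P * F

/-- The operators `∑ i, ∂^i F_i` with `deg F_i ≤ i`. -/
def IsAdmissible {N : ℕ} (D : DiffOp N) : Prop := ∀ i : ℕ, (D i).degree ≤ i

/-- `D` (with `deg F_i ≤ i`) is symmetric with respect to `W`: `⟨P D, Q⟩ = ⟨P, Q D⟩` for all
matrix polynomials `P`, `Q`. -/
def IsSymmetric {N : ℕ} (W : ℝ → Mat N) (D : DiffOp N) : Prop :=
  IsAdmissible D ∧ ∀ P Q : MatPoly N, pairing W (act P D) Q = pairing W P (act Q D)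

/-- Membership in the algebra of those `D` with `deg F_i ≤ i` that have every sequence of
orthogonal polynomials for `W` as eigenfunctions, with matrix eigenvalues acting from the left. -/
def MemAlgebra {N : ℕ} (W : ℝ → Mat N) (D : DiffOp N) : Prop :=
  IsAdmissible D ∧
    ∀ R : ℕ → MatPoly N, IsOrthogonalSeq W R →
      ∃ Γ : ℕ → Mat N, ∀ n, act (R n) D = C (Γ n) * R n

/-! The weight and the operators. The half-integer `ℓ` is encoded by the natural number
`k = 2ℓ`; matrices have size `2ℓ + 1 = k + 1` with rows and columns `0, …, 2ℓ`. -/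

/-- The expression for the entry `(n, m)`, `n ≤ m`, of the polynomial part of the weight:
`(2ℓ+1)/(n+1) · (2ℓ-m)! m!/(2ℓ)! · ∑_{t=0}^{m} (-1)^{m-t} (n-2ℓ)_{m-t}/(n+2)_{m-t}
· (2ℓ+2-t)_t/t! · U_{n+m-2t}(x)`. Negative indices of `U` follow the three term recurrence:
`U_{-1} = 0`, `U_{-r-2} = -U_r`. -/
def weightEntry (k n m : ℕ) (x : ℝ) : ℝ :=
  ((k : ℝ) + 1) / ((n : ℝ) + 1) * (((k - m).factorial : ℝ) * (m.factorial : ℝ)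
      / (k.factorial : ℝ)) *
    ∑ t ∈ Finset.range (m + 1),
      (-1 : ℝ) ^ (m - t)
        * ((ascPochhammer ℝ (m - t)).eval ((n : ℝ) - (k : ℝ))
            / (ascPochhammer ℝ (m - t)).eval ((n : ℝ) + 2))
        * ((ascPochhammer ℝ t).eval ((k : ℝ) + 2 - (t : ℝ)) / (t.factorial : ℝ))
        * (Polynomial.Chebyshev.U ℝ ((n : ℤ) + (m : ℤ) - 2 * (t : ℤ))).eval x

/-- The weight matrix `W(x) = (1-x)^{1/2} (1+x)^{1/2} Z(x)`, symmetric, on `[-1, 1]`. -/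
def weight (k : ℕ) (x : ℝ) : Mat (k + 1) :=
  Matrix.of fun n m =>
    ((√(1 - x) * √(1 + x) *
      (if (n : ℕ) ≤ (m : ℕ) then weightEntry k n m x else weightEntry k m n x) : ℝ) : ℂ)

/-- The half-integer `ℓ = k / 2`. -/
def spin (k : ℕ) : ℂ := (k : ℂ) / 2

/-- The tridiagonal matrix `∑ i, u i • E_{i,i+1} + ∑ i, d i • E_{i,i} + ∑ i, l i • E_{i,i-1}`,
matrix units with an index outside `0, …, k` being zero. -/
def tridiag (k : ℕ) (u d l : ℕ → ℂ) : Mat (k + 1) :=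
  Matrix.of fun i j =>
    if (j : ℕ) = (i : ℕ) + 1 then u i
    else if (j : ℕ) = (i : ℕ) then d i
    else if (i : ℕ) = (j : ℕ) + 1 then l i
    else 0

/-- `A₁(x) = ∑ (2ℓ-i)/(2ℓ) E_{i,i+1} - ∑ x (ℓ-i)/ℓ E_{i,i} - ∑ i/(2ℓ) E_{i,i-1}`. -/
def coeffA1 (k : ℕ) : MatPoly (k + 1) :=
  C (tridiag k (fun i => (2 * spin k - i) / (2 * spin k)) (fun _ => 0)
      (fun i => -((i : ℂ) / (2 * spin k))))
    + C (tridiag k (fun _ => 0) (fun i => -((spin k - i) / spin k)) (fun _ => 0)) * X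

/-- `A₀ = ∑ (2ℓ+2)(i-2ℓ)/(2ℓ) E_{i,i}`. -/
def coeffA0 (k : ℕ) : Mat (k + 1) :=
  tridiag k (fun _ => 0)
    (fun i => (2 * spin k + 2) * (i - 2 * spin k) / (2 * spin k)) (fun _ => 0)

/-- The first order operator `E = ∂ A₁(x) + A₀`. -/
def opE (k : ℕ) : DiffOp (k + 1) :=
  Finsupp.single 1 (coeffA1 k) + Finsupp.single 0 (C (coeffA0 k))

/-- `B₁(x) = ∑ (4ℓ+3)(i-2ℓ)/(2ℓ) E_{i,i+1} - ∑ x (2ℓ+3)(i-2ℓ)/ℓ E_{i,i}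
+ ∑ 3i/(2ℓ) E_{i,i-1}`. -/
def coeffB1 (k : ℕ) : MatPoly (k + 1) :=
  C (tridiag k (fun i => (4 * spin k + 3) * (i - 2 * spin k) / (2 * spin k)) (fun _ => 0)
      (fun i => 3 * (i : ℂ) / (2 * spin k)))
    + C (tridiag k (fun _ => 0)
        (fun i => -((2 * spin k + 3) * (i - 2 * spin k) / spin k)) (fun _ => 0)) * X

/-- `B₀ = ∑ (i-2ℓ)(iℓ-2ℓ²-5ℓ-3)/ℓ E_{i,i}`. -/
def coeffB0 (k : ℕ) : Mat (k + 1) :=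
  tridiag k (fun _ => 0)
    (fun i => (i - 2 * spin k) * (i * spin k - 2 * spin k ^ 2 - 5 * spin k - 3) / spin k)
    (fun _ => 0)

/-- The second order operator `D = (x² - 1) ∂² + ∂ B₁(x) + B₀`. -/
def opD (k : ℕ) : DiffOp (k + 1) :=
  Finsupp.single 2 (X ^ 2 - 1) + Finsupp.single 1 (coeffB1 k)
    + Finsupp.single 0 (C (coeffB0 k))

/-- The eigenvalue
`Λ_n(D) = ∑ i, (n(n-1) - n(2ℓ+3)(i-2ℓ)/ℓ + (i-2ℓ)(iℓ-2ℓ²-5ℓ-3)/ℓ) E_{i,i}`. -/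
def eigenvalueD (k n : ℕ) : Mat (k + 1) :=
  Matrix.diagonal fun i : Fin (k + 1) =>
    (n : ℂ) * ((n : ℂ) - 1)
      - (n : ℂ) * ((2 * spin k + 3) * ((i : ℕ) - 2 * spin k) / spin k)
      + ((i : ℕ) - 2 * spin k) * ((i : ℕ) * spin k - 2 * spin k ^ 2 - 5 * spin k - 3) / spin k

end MVOP

end

noncomputable section

namespace MVOP

/-! Write `W = w Z` with `w = √(1 - x) √(1 + x)`. The Pochhammer factors collapse, so that up to
inverse binomials `Z n m` is a partial sum of `a_t a_{s-t} V_{s-2t}`, with `a_t = (k+1 choose t)`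
and `s = n + m + 1`. The summand is odd under `t ↦ s - t`; hence `Z` is symmetric and its sums can
be cut at either index.

Symmetry of `D` reduces to two equations for `W`: `2((x² - 1)W)' = B₁W + WB₁ᵀ` and `(WB₁ᵀ - B₁W)' =
-2(B₀W - WB₀)`. Entrywise both telescope in the cut-off (`chebSum_first_order`,
`chebSum_second_order`). They make `w` times the difference of the two integrands a derivative
(`green_identity`), and the boundary terms vanish because `w(±1) = 0`.

`D` does not raise degrees, so symmetry makes `R_n D - Γ R_n` orthogonal to everything when `Γ` is
fitted to the leading coefficient. Nondegeneracy needs no positivity of `W`: testing `T` against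
`TZ` gives `TZ = 0`, and the top coefficient of `Z` is an invertible antidiagonal matrix.

Commutation is a comparison of the coefficients of `P'''`, `P''`, `P'` and `P`. -/

/-! ### Chebyshev identities -/

/-- The Chebyshev polynomial with `V i (cos θ) = sin (i θ) / sin θ`. -/
def chebV (i : ℤ) : ℂ[X] := Chebyshev.U ℂ (i - 1)

lemma chebV_neg (i : ℤ) : chebV (-i) = -chebV i := by
  rw [chebV, chebV, ← Chebyshev.U_neg_sub_one]

lemma chebV_zero : chebV 0 = 0 := by simp [chebV]

lemma two_X_mul_chebV (i : ℤ) : 2 * X * chebV i = chebV (i + 1) + chebV (i - 1) := by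
  have := Chebyshev.U_add_one ℂ (i - 1)
  simp only [chebV]
  rw [show i + 1 - 1 = i - 1 + 1 by ring, this]; ring

lemma two_X_mul_T (i : ℤ) :
    2 * X * Chebyshev.T ℂ i = Chebyshev.T ℂ (i + 1) + Chebyshev.T ℂ (i - 1) := by
  rw [Chebyshev.T_add_one]; ring

lemma two_one_sub_X_sq_mul_chebV (i : ℤ) :
    2 * (1 - X ^ 2) * chebV i = Chebyshev.T ℂ (i - 1) - Chebyshev.T ℂ (i + 1) := by
  have h := Chebyshev.one_sub_X_sq_mul_U_eq_pol_in_T ℂ (i - 1)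
  have h2 := Chebyshev.T_add_one ℂ i
  rw [show i - 1 + 1 = i by ring, show i - 1 + 2 = i + 1 by ring] at h
  simp only [chebV]
  linear_combination 2 * h - h2

lemma T_eq_chebV (i : ℤ) : 2 * Chebyshev.T ℂ i = chebV (i + 1) - chebV (i - 1) := by
  have := Chebyshev.two_mul_T_eq_U_sub_U ℂ (i - 2)
  simp only [chebV]
  rw [show i - 2 + 2 = i by ring] at this
  rw [this]; ring_nf

/-- The operator `f ↦ (1 - x²) f' - x f`, conjugate to `√(1 - x²) d/dx ∘ √(1 - x²)`. -/
def chebD : ℂ[X] →ₗ[ℂ] ℂ[X] :=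
  LinearMap.mulLeft ℂ (1 - X ^ 2) ∘ₗ derivative - LinearMap.mulLeft ℂ X

lemma chebD_apply (f : ℂ[X]) : chebD f = (1 - X ^ 2) * derivative f - X * f := rfl

/-- With `x = cos θ` this is the derivative of `√(1 - x²) V_i = sin (i θ)`. -/
lemma chebD_chebV (i : ℤ) : chebD (chebV i) = -(i : ℂ[X]) * Chebyshev.T ℂ i := by
  have h := Chebyshev.add_one_mul_T_eq_poly_in_U (R := ℂ) (i - 1)
  rw [chebD_apply, chebV]
  rw [show i - 1 + 1 = i by ring] at h
  push_cast at h
  linear_combination h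

lemma chebD_C_mul (c : ℂ) (f : ℂ[X]) : chebD (C c * f) = C c * chebD f := by
  simp only [chebD_apply, derivative_mul, derivative_C]; ring

lemma chebV_derivative (i : ℤ) :
    2 * (3 * X * chebV i + (X ^ 2 - 1) * derivative (chebV i))
      = (i + 2 : ℂ[X]) * chebV (i + 1) - (i - 2 : ℂ[X]) * chebV (i - 1) := by
  have h := chebD_chebV i
  rw [chebD_apply] at h
  linear_combination -2 * h + 2 * two_X_mul_chebV i + (i : ℂ[X]) * T_eq_chebV i

/-! ### Binomial sums of Chebyshev polynomials -/

/-- The binomial coefficient `(k+1 choose t)` as a constant polynomial. -/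
def binC (k t : ℕ) : ℂ[X] := ((k + 1).choose t : ℕ)

lemma binC_succ (k t : ℕ) : ((t : ℂ[X]) + 1) * binC k (t + 1) = (k + 1 - t : ℂ[X]) * binC k t := by
  rcases le_or_gt t (k + 1) with h | h
  · have := Nat.choose_succ_right_eq (k + 1) t
    have h2 := congrArg (Nat.cast (R := ℂ[X])) this
    push_cast [Nat.cast_sub h] at h2
    rw [binC, binC]; linear_combination h2
  · rw [binC, binC, Nat.choose_eq_zero_of_lt h, Nat.choose_eq_zero_of_lt (by omega)]; simp

lemma derivative_binC (k t : ℕ) : derivative (binC k t) = 0 := by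
  simp [binC]

/-- The partial sums `∑_{t < r} a_t a_{s-t} V_{s-2t}` with `a_t = (k+1 choose t)`. -/
def chebSum (k s r : ℕ) : ℂ[X] :=
  ∑ t ∈ Finset.range r, binC k t * binC k (s - t) * chebV ((s : ℤ) - 2 * t)

lemma chebSum_succ (k s r : ℕ) : chebSum k s (r + 1)
    = chebSum k s r + binC k r * binC k (s - r) * chebV ((s : ℤ) - 2 * r) :=
  Finset.sum_range_succ _ _

lemma chebSum_zero (k s : ℕ) : chebSum k s 0 = 0 := rfl

/-- The summand is odd under `t ↦ s - t`, so the last `r'` terms are minus the first `r'`. -/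
lemma chebSum_add (k r r' : ℕ) : ∀ s, r + r' = s + 1 →
    chebSum k s (s + 1) = chebSum k s r - chebSum k s r' := by
  intro s h
  rw [← h, chebSum, Finset.sum_range_add, sub_eq_add_neg, chebSum, chebSum,
    ← Finset.sum_range_reflect (n := r'), ← Finset.sum_neg_distrib]
  congr 1
  refine Finset.sum_congr rfl fun t ht => ?_
  rw [Finset.mem_range] at ht
  rw [show r + (r' - 1 - t) = s - t by omega, show s - (s - t) = t by omega,
    Nat.cast_sub (by omega), show (s : ℤ) - 2 * (s - t) = -(s - 2 * t) by ring, chebV_neg]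
  ring

lemma chebSum_full (k s : ℕ) : chebSum k s (s + 1) = 0 := by
  have h := chebSum_add k 0 (s + 1) s (by omega)
  rw [chebSum_zero, zero_sub] at h
  exact self_eq_neg.mp h

lemma chebSum_reflect {k s r r' : ℕ} (h : r + r' = s + 1) : chebSum k s r = chebSum k s r' := by
  have := chebSum_add k r r' s h
  rw [chebSum_full] at this
  exact (sub_eq_zero.mp this.symm)

/-- Telescoping in `r`: the right side is the discrete antiderivative of the summand. For `s = n + m
+ 1`, `r = n + 1` this is the first symmetry equation up to boundary terms. The bound `r ≤ s` keeps
the truncated index differences genuine. -/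
lemma chebSum_first_order (k s : ℕ) : ∀ r ≤ s,
    (2 * k : ℂ[X]) * (3 * (X : ℂ[X]) * chebSum k s r
        + ((X : ℂ[X]) ^ 2 - 1) * derivative (chebSum k s r))
      + (2 * k + 3 : ℂ[X]) * (s + 1 : ℂ[X]) * chebSum k (s + 1) r
      - 2 * (k + 3 : ℂ[X]) * (2 * k + 1 - s : ℂ[X]) * (X : ℂ[X]) * chebSum k s r
      - 3 * (2 * k + 3 - s : ℂ[X]) * chebSum k (s - 1) r
    = -((r : ℂ[X]) * binC k r * chebV ((s : ℤ) + 1 - 2 * r)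
        * ((2 * k + 3 : ℂ[X]) * binC k (s + 1 - r) + 3 * binC k (s - r))) := by
  intro r
  induction r with
  | zero => intro _; simp [chebSum_zero]
  | succ t ih =>
    intro h
    obtain ⟨j, rfl⟩ : ∃ j, s = t + j + 1 := ⟨s - t - 1, by omega⟩
    specialize ih (by omega)
    simp only [chebSum_succ, map_add, derivative_mul, derivative_binC]
    rw [show t + j + 1 - t = j + 1 by omega, show t + j + 1 + 1 - t = j + 2 by omega,
      show t + j + 1 - 1 - t = j by omega, show t + j + 1 - (t + 1) = j by omega,
      show t + j + 1 + 1 - (t + 1) = j + 1 by omega] at *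
    have hV := chebV_derivative (((t + j + 1 : ℕ) : ℤ) - 2 * t)
    have hX := two_X_mul_chebV (((t + j + 1 : ℕ) : ℤ) - 2 * t)
    have e1 : (((t + j + 1 + 1 : ℕ) : ℤ) - 2 * t) = ((t + j + 1 : ℕ) : ℤ) - 2 * t + 1 := by
      push_cast; ring
    have e2 : (((t + j + 1 - 1 : ℕ) : ℤ) - 2 * t) = ((t + j + 1 : ℕ) : ℤ) - 2 * t - 1 := by
      push_cast; ring
    have e3 : (((t + j + 1 : ℕ) : ℤ) + 1 - 2 * t) = ((t + j + 1 : ℕ) : ℤ) - 2 * t + 1 := by ring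
    have e4 : (((t + j + 1 : ℕ) : ℤ) + 1 - 2 * (t + 1 : ℕ))
      = ((t + j + 1 : ℕ) : ℤ) - 2 * t - 1 := by push_cast; ring
    rw [e3] at ih
    rw [e1, e2, e4]
    have b1 := binC_succ k t
    have b2 := binC_succ k j
    have b3 := binC_succ k (j + 1)
    generalize chebV (((t + j + 1 : ℕ) : ℤ) - 2 * t + 1) = Vp at *
    generalize chebV (((t + j + 1 : ℕ) : ℤ) - 2 * t - 1) = Vm at *
    generalize derivative (chebV (((t + j + 1 : ℕ) : ℤ) - 2 * t)) = V' at *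
    generalize chebV (((t + j + 1 : ℕ) : ℤ) - 2 * t) = V at *
    push_cast at *
    -- `hV` and `hX` reduce the new summand to multiples of `V_{i+1}` and `V_{i-1}`, with `i = s -
    -- 2t`; the ratios of consecutive binomials match these with the boundary terms.
    linear_combination ih + (k : ℂ[X]) * binC k t * binC k (j + 1) * hV
      - (k + 3) * (2 * k - t - j) * binC k t * binC k (j + 1) * hX
      + (2 * k + 3) * binC k t * Vp * b3
      + Vm * ((2 * k + 3) * binC k (j + 1) + 3 * binC k j) * b1
      + 3 * binC k t * Vm * b2

/-- The second symmetry equation with the common factor `m - n` removed; it telescopes in `r` with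
`T` in place of `V`. -/
lemma chebSum_second_order (k s : ℕ) : ∀ r ≤ s,
    chebD (-((2 * k + 3 : ℂ[X]) * chebSum k (s + 1) r)
        - 2 * (k + 3 : ℂ[X]) * (X * chebSum k s r) - 3 * chebSum k (s - 1) r)
      + 2 * (1 - X ^ 2) * (2 * k ^ 2 + 6 * k + 6 - k * s : ℂ[X]) * chebSum k s r
    = (r : ℂ[X]) * binC k r * Chebyshev.T ℂ ((s : ℤ) + 1 - 2 * r)
        * ((2 * k + 3 : ℂ[X]) * binC k (s + 1 - r) + 3 * binC k (s - r)) := by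
  intro r
  induction r with
  | zero => intro _; simp [chebSum_zero]
  | succ t ih =>
    intro h
    obtain ⟨j, rfl⟩ : ∃ j, s = t + j + 1 := ⟨s - t - 1, by omega⟩
    specialize ih (by omega)
    simp only [chebSum_succ, chebD_apply, derivative_sub, derivative_neg, derivative_mul,
      derivative_add, derivative_binC, derivative_X, derivative_natCast, derivative_ofNat] at ih ⊢
    rw [show t + j + 1 - t = j + 1 by omega, show t + j + 1 + 1 - t = j + 2 by omega,
      show t + j + 1 - 1 - t = j by omega, show t + j + 1 - (t + 1) = j by omega,
      show t + j + 1 + 1 - (t + 1) = j + 1 by omega] at *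
    have e1 : (((t + j + 1 + 1 : ℕ) : ℤ) - 2 * t) = ((t + j + 1 : ℕ) : ℤ) - 2 * t + 1 := by
      push_cast; ring
    have e2 : (((t + j + 1 - 1 : ℕ) : ℤ) - 2 * t) = ((t + j + 1 : ℕ) : ℤ) - 2 * t - 1 := by
      push_cast; ring
    have e3 : (((t + j + 1 : ℕ) : ℤ) + 1 - 2 * t) = ((t + j + 1 : ℕ) : ℤ) - 2 * t + 1 := by ring
    have e4 : (((t + j + 1 : ℕ) : ℤ) + 1 - 2 * (t + 1 : ℕ))
      = ((t + j + 1 : ℕ) : ℤ) - 2 * t - 1 := by push_cast; ring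
    rw [e3] at ih
    rw [e1, e2, e4]
    have hi : (((((t + j + 1 : ℕ) : ℤ) - 2 * t : ℤ)) : ℂ[X]) = (j : ℂ[X]) + 1 - t := by
      push_cast; ring
    generalize ((t + j + 1 : ℕ) : ℤ) - 2 * t = i at *
    have hP := chebD_chebV (i + 1)
    have h0 := chebD_chebV i
    have hM := chebD_chebV (i - 1)
    have hV := two_one_sub_X_sq_mul_chebV i
    have hX := two_X_mul_T i
    have b1 := binC_succ k t
    have b2 := binC_succ k j
    have b3 := binC_succ k (j + 1)
    rw [chebD_apply] at hP h0 hM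
    push_cast at hP hM b3
    rw [hi] at hP h0 hM
    push_cast at ih ⊢
    generalize derivative (chebV (i + 1)) = Vp' at *
    generalize derivative (chebV (i - 1)) = Vm' at *
    generalize derivative (chebV i) = V' at *
    generalize chebV (i + 1) = Vp at *
    generalize chebV (i - 1) = Vm at *
    generalize chebV i = V at *
    generalize Chebyshev.T ℂ (i + 1) = Tp at *
    generalize Chebyshev.T ℂ (i - 1) = Tm at *
    generalize Chebyshev.T ℂ i = T at *
    linear_combination ih - (2 * k + 3) * binC k t * binC k (j + 2) * hP
      - 2 * (k + 3) * X * binC k t * binC k (j + 1) * h0 - 3 * binC k t * binC k j * hM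
      + (2 * k ^ 2 + 6 * k + 6 - k * (t + j + 1) - (k + 3)) * binC k t * binC k (j + 1) * hV
      + (k + 3) * (j + 1 - t) * binC k t * binC k (j + 1) * hX
      + (2 * k + 3) * binC k t * Tp * b3
      - Tm * ((2 * k + 3) * binC k (j + 1) + 3 * binC k j) * b1
      + 3 * binC k t * Tm * b2

/-! ### Binomial form of the weight -/

lemma choose_mul_descFactorial (K a j : ℕ) :
    K.choose a * (K - a).descFactorial j = K.choose (a + j) * (a + 1).ascFactorial j := by
  induction j with
  | zero => simp
  | succ j ih =>
    rw [Nat.descFactorial_succ, Nat.ascFactorial_succ, ← add_assoc]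
    have h := Nat.choose_succ_right_eq K (a + j)
    calc K.choose a * ((K - a - j) * (K - a).descFactorial j)
        = (K - (a + j)) * (K.choose a * (K - a).descFactorial j) := by
          rw [Nat.sub_sub]; ring
      _ = (K.choose (a + j) * (K - (a + j))) * (a + 1).ascFactorial j := by rw [ih]; ring
      _ = _ := by rw [← h]; ring

lemma weight_coeff_eq {k n m t : ℕ} (hn : n ≤ k) (hm : m ≤ k) (ht : t ≤ m) :
    ((k : ℝ) + 1) / ((n : ℝ) + 1) * (((k - m).factorial : ℝ) * (m.factorial : ℝ)
      / (k.factorial : ℝ)) * ((-1 : ℝ) ^ (m - t)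
        * ((ascPochhammer ℝ (m - t)).eval ((n : ℝ) - (k : ℝ))
            / (ascPochhammer ℝ (m - t)).eval ((n : ℝ) + 2))
        * ((ascPochhammer ℝ t).eval ((k : ℝ) + 2 - (t : ℝ)) / (t.factorial : ℝ)))
      = ((k.choose n : ℝ))⁻¹ * ((k.choose m : ℝ))⁻¹
        * (((k + 1).choose t : ℝ) * ((k + 1).choose (n + m + 1 - t) : ℝ)) := by
  obtain ⟨j, rfl⟩ : ∃ j, m = t + j := ⟨m - t, by omega⟩
  have h1 : (-1 : ℝ) ^ j * (ascPochhammer ℝ j).eval ((n : ℝ) - (k : ℝ))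
      = ((k - n).descFactorial j : ℝ) := by
    rw [← descPochhammer_eval_eq_descFactorial ℝ, Nat.cast_sub hn,
      show (n : ℝ) - k = -((k : ℝ) - n) by ring, ascPochhammer_eval_neg_eq_descPochhammer,
      ← mul_assoc, ← mul_pow]
    simp
  have h2 : (ascPochhammer ℝ j).eval ((n : ℝ) + 2) = ((n + 1 + 1).ascFactorial j : ℝ) := by
    rw [← ascPochhammer_nat_eq_ascFactorial, ascPochhammer_eval_cast]
    push_cast; ring_nf
  have h3 : (ascPochhammer ℝ t).eval ((k : ℝ) + 2 - (t : ℝ)) / (t.factorial : ℝ)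
      = ((k + 1).choose t : ℝ) := by
    rw [div_eq_iff (by positivity)]
    have : (k : ℝ) + 2 - t = ((k + 1 - t + 1 : ℕ) : ℝ) := by
      push_cast [Nat.cast_sub (show t ≤ k + 1 by omega)]; ring
    rw [this, ← ascPochhammer_eval_cast, ascPochhammer_nat_eq_ascFactorial,
      Nat.ascFactorial_eq_factorial_mul_choose (k + 1 - t) t,
      show k + 1 - t + t = k + 1 by omega]
    push_cast; ring
  have h4 : (((k - (t + j)).factorial : ℝ) * ((t + j).factorial : ℝ) / (k.factorial : ℝ))
      = ((k.choose (t + j) : ℝ))⁻¹ := by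
    rw [Nat.cast_choose ℝ hm, inv_div, mul_comm]
  have h5 := congrArg (Nat.cast (R := ℝ)) (Nat.add_one_mul_choose_eq k n)
  have h6 := congrArg (Nat.cast (R := ℝ)) (choose_mul_descFactorial (k + 1) (n + 1) j)
  rw [Nat.add_sub_add_right] at h6
  push_cast at h5 h6
  have hc : (k.choose n : ℝ) ≠ 0 := by exact_mod_cast (Nat.choose_pos hn).ne'
  have ha : ((n + 1 + 1).ascFactorial j : ℝ) ≠ 0 := by
    exact_mod_cast (Nat.ascFactorial_pos _ _).ne'
  rw [Nat.add_sub_cancel_left, h2, h3, h4, ← mul_div_assoc, h1,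
    show n + (t + j) + 1 - t = n + 1 + j by omega]
  -- Absorption, `(k+1)(k choose n) = (n+1)(k+1 choose n+1)`, followed by moving the lower index up
  -- by `j`.
  have h7 : ((k : ℝ) + 1) / (n + 1) * (((k - n).descFactorial j : ℝ)
      / ((n + 1 + 1).ascFactorial j : ℝ)) = (k.choose n : ℝ)⁻¹ * ((k + 1).choose (n + 1 + j) : ℝ) := by
    field_simp
    linear_combination ((k - n).descFactorial j : ℝ) * h5 + (n + 1) * h6
  linear_combination (k.choose (t + j) : ℝ)⁻¹ * ((k + 1).choose t : ℝ) * h7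

/-- The factor `1 / (k choose n)`. -/
def invBin (k n : ℕ) : ℂ := (k.choose n : ℂ)⁻¹

/-- The polynomial part of the weight matrix. -/
def weightPoly (k : ℕ) (n m : ℕ) : ℂ[X] :=
  C (invBin k n * invBin k m) * chebSum k (n + m + 1) (n + 1)

lemma weightPoly_comm (k n m : ℕ) : weightPoly k n m = weightPoly k m n := by
  rw [weightPoly, weightPoly, mul_comm (invBin k n), add_comm m n,
    chebSum_reflect (show n + 1 + (m + 1) = n + m + 1 + 1 by ring)]

lemma ofReal_weightEntry {k n m : ℕ} (hn : n ≤ k) (hm : m ≤ k) (x : ℝ) :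
    ((weightEntry k n m x : ℝ) : ℂ) = (weightPoly k n m).eval (x : ℂ) := by
  -- The given formula sums over `t ≤ m`, whereas `weightPoly k n m` is cut at `t ≤ n`; reflection
  -- exchanges the two.
  rw [weightPoly_comm, weightPoly, weightEntry, Finset.mul_sum, chebSum, Complex.ofReal_sum,
    Finset.mul_sum, eval_finsetSum]
  refine Finset.sum_congr rfl fun t ht => ?_
  rw [Finset.mem_range] at ht
  rw [← mul_assoc, weight_coeff_eq hn hm (by omega), Complex.ofReal_mul,
    Chebyshev.complex_ofReal_eval_U]
  simp only [invBin, binC, chebV, eval_mul, eval_C, eval_natCast]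
  push_cast
  rw [show (m : ℤ) + n + 1 - 2 * t - 1 = n + m - 2 * t by ring, add_comm m n]
  ring

lemma weight_apply (k : ℕ) (x : ℝ) (n m : Fin (k + 1)) :
    weight k x n m = ((√(1 - x) * √(1 + x) : ℝ) : ℂ) * (weightPoly k n m).eval (x : ℂ) := by
  rw [weight, Matrix.of_apply]
  split_ifs
  · rw [Complex.ofReal_mul, ofReal_weightEntry (by omega) (by omega)]
  · rw [Complex.ofReal_mul, ofReal_weightEntry (by omega) (by omega), weightPoly_comm]

/-! ### Top coefficients of the weight -/

lemma coeff_chebV_eq_zero {i : ℤ} {d : ℕ} (hd : i.natAbs ≤ d) (h0 : i ≠ 0) :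
    (chebV i).coeff d = 0 := by
  refine coeff_eq_zero_of_natDegree_lt ?_
  rw [chebV, Chebyshev.natDegree_U]
  omega

/-- A nonzero term has `t ≤ k` and `s - t ≤ k + 1`, so `|s - 2t| ≤ k + 1`, with equality only for `t
= 0`, `s = k + 1`; and `V_i` has degree `|i| - 1` for `i ≠ 0`. -/
lemma coeff_chebSum {k s r d : ℕ} (hr : r ≤ k + 1) (hrs : r ≤ s) (hr0 : 0 < r) (hd : k ≤ d) :
    (chebSum k s r).coeff d = if s = k + 1 ∧ d = k then 2 ^ k else 0 := by
  have key : ∀ t, t ≤ k → t ≤ s → ¬ (t = 0 ∧ s = k + 1 ∧ d = k) →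
      (binC k t * binC k (s - t) * chebV ((s : ℤ) - 2 * t)).coeff d = 0 := by
    intro t ht hts h
    rw [binC, binC, ← Nat.cast_mul, ← C_eq_natCast, coeff_C_mul]
    rcases Nat.lt_or_ge (k + 1) (s - t) with h1 | h1
    · simp [Nat.choose_eq_zero_of_lt h1]
    · by_cases h0 : (s : ℤ) - 2 * t = 0
      · simp [h0, chebV_zero]
      · rw [coeff_chebV_eq_zero (by omega) h0, mul_zero]
  rw [chebSum, finsetSum_coeff]
  split_ifs with h
  · obtain ⟨rfl, rfl⟩ := h
    rw [Finset.sum_eq_single 0]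
    · have h2 := Chebyshev.leadingCoeff_U_natCast ℂ d
      rw [leadingCoeff, Chebyshev.natDegree_U_natCast] at h2
      simpa [binC, chebV] using h2
    · intro t ht h0
      rw [Finset.mem_range] at ht
      exact key t (by omega) (by omega) (by tauto)
    · intro h; exact absurd (Finset.mem_range.mpr hr0) h
  · refine Finset.sum_eq_zero fun t ht => ?_
    rw [Finset.mem_range] at ht
    exact key t (by omega) (by omega) (by tauto)

lemma coeff_weightPoly {k n m d : ℕ} (hn : n ≤ k) (hd : k ≤ d) :
    (weightPoly k n m).coeff d
      = if n + m = k ∧ d = k then invBin k n * invBin k m * 2 ^ k else 0 := by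
  rw [weightPoly, coeff_C_mul, coeff_chebSum (by omega) (by omega) (by omega) hd]
  simp

/-! ### Symmetry equations, entry by entry -/

lemma sum_tridiag_mul {k : ℕ} {u d l : ℕ → ℂ} (hu : u k = 0) (hl : l 0 = 0) (i : Fin (k + 1))
    (g : ℕ → ℂ[X]) :
    ∑ j : Fin (k + 1), C (tridiag k u d l i j) * g j
      = C (u i) * g (i + 1) + C (d i) * g i + C (l i) * g (i - 1) := by
  obtain ⟨i, hi⟩ := i
  have h : ∀ j : ℕ, C (if j = i + 1 then u i else if j = i then d i
      else if i = j + 1 then l i else 0) * g j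
      = (if j = i + 1 then C (u i) * g j else 0) + (if j = i then C (d i) * g j else 0)
        + (if i = j + 1 then C (l i) * g j else 0) := by
    intro j
    split_ifs <;> first | omega | simp
  simp only [tridiag, Matrix.of_apply]
  rw [Fin.sum_univ_eq_sum_range (fun j => C (if j = i + 1 then u i else if j = i then d i
      else if i = j + 1 then l i else 0) * g j) (k + 1), Finset.sum_congr rfl fun j _ => h j,
    Finset.sum_add_distrib, Finset.sum_add_distrib, Finset.sum_ite_eq', Finset.sum_ite_eq']
  congr 1
  · congr 1
    · split_ifs with h1
      · rfl
      · rw [Finset.mem_range] at h1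
        rw [show i = k by omega, hu]; simp
    · rw [if_pos (Finset.mem_range.mpr hi)]
  · rcases i with _ | i
    · simp [hl]
    · simp only [add_left_inj, Nat.add_sub_cancel]
      rw [Finset.sum_ite_eq, if_pos (Finset.mem_range.mpr (by omega))]

/-- The polynomial part of the weight, as a matrix of polynomials. -/
def weightMat (k : ℕ) : Matrix (Fin (k + 1)) (Fin (k + 1)) ℂ[X] :=
  Matrix.of fun n m => weightPoly k n m

lemma weightMat_transpose (k : ℕ) : (weightMat k).transpose = weightMat k := by
  ext1 n m
  exact weightPoly_comm k m n

lemma invBin_succ {k n : ℕ} (h : n < k) :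
    ((k : ℂ) - n) * invBin k (n + 1) = ((n : ℂ) + 1) * invBin k n := by
  have h1 := congrArg (Nat.cast (R := ℂ)) (Nat.choose_succ_right_eq k n)
  push_cast [Nat.cast_sub h.le] at h1
  have h2 : (k.choose n : ℂ) ≠ 0 := by exact_mod_cast (Nat.choose_pos h.le).ne'
  have h3 : (k.choose (n + 1) : ℂ) ≠ 0 := by exact_mod_cast (Nat.choose_pos h).ne'
  rw [invBin, invBin]
  field_simp
  linear_combination -h1

/-- After reflection every term contains a binomial `(k+1 choose j)` with `j > k + 1`. This settles
the last row, `n = k`, in `sub_mul_weightPoly_succ`. -/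
lemma chebSum_eq_zero (k m : ℕ) : chebSum k (k + m + 2) (k + 2) = 0 := by
  rw [chebSum_reflect (show k + 2 + (m + 1) = k + m + 2 + 1 by ring)]
  refine Finset.sum_eq_zero fun t ht => ?_
  rw [Finset.mem_range] at ht
  simp [binC, Nat.choose_eq_zero_of_lt (show k + 1 < k + m + 2 - t by omega)]

lemma sub_mul_weightPoly_succ {k n : ℕ} (h : n ≤ k) (m : ℕ) :
    (k - n : ℂ[X]) * weightPoly k (n + 1) m
      = C (invBin k n * invBin k m) * ((n + 1 : ℂ[X]) * chebSum k (n + m + 2) (n + 2)) := by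
  rw [weightPoly, show n + 1 + m + 1 = n + m + 2 by ring]
  rcases h.eq_or_lt with rfl | h
  · rw [chebSum_eq_zero]; simp
  · have h1 := congrArg C (invBin_succ h)
    simp only [C_mul, C_sub, C_add, C_1, ← C_eq_natCast] at h1 ⊢
    linear_combination C (invBin k m) * chebSum k (n + m + 2) (n + 2) * h1

lemma mul_weightPoly_pred {k n : ℕ} (h : n ≤ k) (m : ℕ) :
    (n : ℂ[X]) * weightPoly k (n - 1) m
      = C (invBin k n * invBin k m) * ((k + 1 - n : ℂ[X]) * chebSum k (n + m) n) := by
  rcases n with _ | n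
  · simp [chebSum_zero]
  · have h1 := congrArg C (invBin_succ (show n < k by omega))
    rw [weightPoly, show n + 1 - 1 = n by omega, show n + m + 1 = n + 1 + m by ring]
    simp only [C_mul, C_sub, C_add, C_1, ← C_eq_natCast, Nat.cast_add, Nat.cast_one] at h1 ⊢
    linear_combination -C (invBin k m) * chebSum k (n + 1 + m) (n + 1) * h1

lemma spin_ne_zero {k : ℕ} (hk : 1 ≤ k) : spin k ≠ 0 := by
  have : (k : ℂ) ≠ 0 := by exact_mod_cast (by omega : k ≠ 0)
  simp [spin, this]

lemma two_mul_spin (k : ℕ) : 2 * spin k = k := by rw [spin]; ring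

/-- The coefficient `B₁` as a matrix of polynomials. -/
def matB1 (k : ℕ) : Matrix (Fin (k + 1)) (Fin (k + 1)) ℂ[X] := matPolyEquiv.symm (coeffB1 k)

/-- The coefficient `B₀` as a matrix of polynomials. -/
def matB0 (k : ℕ) : Matrix (Fin (k + 1)) (Fin (k + 1)) ℂ[X] := (coeffB0 k).map C

lemma matB1_apply (k : ℕ) (i j : Fin (k + 1)) :
    matB1 k i j = C (tridiag k (fun i => (4 * spin k + 3) * (i - 2 * spin k) / (2 * spin k))
      (fun _ => 0) (fun i => 3 * (i : ℂ) / (2 * spin k)) i j)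
      + C (tridiag k (fun _ => 0)
        (fun i => -((2 * spin k + 3) * (i - 2 * spin k) / spin k)) (fun _ => 0) i j) * X := by
  ext d
  rw [matB1, matPolyEquiv_symm_apply_coeff, coeffB1]
  rcases d with _ | d <;> simp [coeff_C, coeff_X]
  split_ifs <;> simp

/-- The factors `k - n` and `n` in `B₁` turn the inverse binomials of the neighbouring rows into
that of row `n`; multiplying by `k` clears the denominators in `ℓ`. -/
lemma matB1_mul_weightMat {k : ℕ} (hk : 1 ≤ k) (n m : Fin (k + 1)) :
    (k : ℂ[X]) * (matB1 k * weightMat k) n m = C (invBin k n * invBin k m) *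
      (-((2 * k + 3 : ℂ[X]) * ((n : ℕ) + 1 : ℂ[X]) * chebSum k (n + m + 2) (n + 2))
        + 2 * (k + 3 : ℂ[X]) * (k - (n : ℕ) : ℂ[X]) * ((X : ℂ[X]) * chebSum k (n + m + 1) (n + 1))
        + 3 * (k + 1 - (n : ℕ) : ℂ[X]) * chebSum k (n + m) n) := by
  have hk0 : (k : ℂ) ≠ 0 := by exact_mod_cast (by omega : k ≠ 0)
  have e1 : (k : ℂ[X]) * C ((4 * spin k + 3) * ((n : ℕ) - 2 * spin k) / (2 * spin k))
      = -((2 * k + 3 : ℂ[X]) * (k - (n : ℕ) : ℂ[X])) := by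
    simp only [← C_eq_natCast, ← C_mul, ← C_ofNat, ← C_add, ← C_sub, ← C_neg]
    congr 1; rw [two_mul_spin, spin]; field_simp; ring
  have e2 : (k : ℂ[X]) * C (3 * ((n : ℕ) : ℂ) / (2 * spin k)) = 3 * ((n : ℕ) : ℂ[X]) := by
    simp only [← C_eq_natCast, ← C_mul, ← C_ofNat]
    congr 1; rw [two_mul_spin]; field_simp
  have e3 : (k : ℂ[X]) * C (-((2 * spin k + 3) * ((n : ℕ) - 2 * spin k) / spin k))
      = 2 * (k + 3 : ℂ[X]) * (k - (n : ℕ) : ℂ[X]) := by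
    simp only [← C_eq_natCast, ← C_mul, ← C_ofNat, ← C_add, ← C_sub]
    congr 1; rw [two_mul_spin, spin]; field_simp; ring
  have h1 := sub_mul_weightPoly_succ (show (n : ℕ) ≤ k by omega) m
  have h2 := mul_weightPoly_pred (show (n : ℕ) ≤ k by omega) m
  have h3 : weightPoly k n m
    = C (invBin k n * invBin k m) * chebSum k (n + m + 1) (n + 1) := rfl
  have h4 : (matB1 k * weightMat k) n m
      = ∑ j : Fin (k + 1), C (tridiag k
          (fun i => (4 * spin k + 3) * (i - 2 * spin k) / (2 * spin k))
          (fun _ => 0) (fun i => 3 * (i : ℂ) / (2 * spin k)) n j) * weightPoly k j m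
        + ∑ j : Fin (k + 1), C (tridiag k (fun _ => 0)
          (fun i => -((2 * spin k + 3) * (i - 2 * spin k) / spin k)) (fun _ => 0) n j)
          * (X * weightPoly k j m) := by
    rw [Matrix.mul_apply, ← Finset.sum_add_distrib]
    refine Finset.sum_congr rfl fun j _ => ?_
    rw [matB1_apply, weightMat, Matrix.of_apply]; ring
  rw [h4, sum_tridiag_mul (by simp [two_mul_spin]) (by simp) n (fun j => weightPoly k j m),
    sum_tridiag_mul rfl rfl n (fun j => X * weightPoly k j m),
    C_0, zero_mul, zero_mul, zero_mul, add_zero, add_zero, zero_add]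
  generalize C ((4 * spin k + 3) * ((n : ℕ) - 2 * spin k) / (2 * spin k)) = u at *
  generalize C (3 * ((n : ℕ) : ℂ) / (2 * spin k)) = l at *
  generalize C (-((2 * spin k + 3) * ((n : ℕ) - 2 * spin k) / spin k)) = d at *
  linear_combination weightPoly k (n + 1) m * e1 + weightPoly k (n - 1) m * e2
    + X * weightPoly k n m * e3 + 2 * (k + 3 : ℂ[X]) * (k - (n : ℕ) : ℂ[X]) * X * h3
    - (2 * k + 3 : ℂ[X]) * h1 + 3 * h2

/-- The entrywise derivative of a matrix of polynomials. -/
def matDeriv {N : ℕ} : Matrix (Fin N) (Fin N) ℂ[X] →ₗ[ℂ] Matrix (Fin N) (Fin N) ℂ[X] :=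
  derivative.mapMatrix

lemma matDeriv_apply {N : ℕ} (M : Matrix (Fin N) (Fin N) ℂ[X]) (i j : Fin N) :
    matDeriv M i j = derivative (M i j) := rfl

/-- Reflection brings all sums of the transposed entry to the cut `n + 1`; those of the entry itself
are off by at most one term, and these terms cancel the telescoping boundary. -/
lemma weight_first_order_entry {k : ℕ} (hk : 1 ≤ k) (n m : Fin (k + 1)) :
    2 * (3 * X * weightPoly k n m + (X ^ 2 - 1) * derivative (weightPoly k n m))
      = (matB1 k * weightMat k) n m + (matB1 k * weightMat k) m n := by
  have hk0 : (k : ℂ[X]) ≠ 0 := by exact_mod_cast (by omega : k ≠ 0)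
  refine mul_left_cancel₀ hk0 ?_
  have h := chebSum_first_order k (n + m + 1) (n + 1) (by omega)
  rw [mul_add _ ((matB1 k * weightMat k) n m), matB1_mul_weightMat hk, matB1_mul_weightMat hk,
    weightPoly,
    mul_comm (invBin k m), add_comm (m : ℕ) (n : ℕ),
    chebSum_reflect (show (m : ℕ) + 2 + (n + 1) = n + m + 2 + 1 by ring),
    chebSum_reflect (show (m : ℕ) + 1 + (n + 1) = n + m + 1 + 1 by ring),
    chebSum_reflect (show (m : ℕ) + (n + 1) = n + m + 1 by ring),
    chebSum_succ k (n + m + 2) (n + 1), derivative_mul, derivative_C]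
  have h2 := chebSum_succ k (n + m) n
  rw [show (n : ℕ) + m + 1 + 1 - (n + 1) = m + 1 by omega,
    show (n : ℕ) + m + 1 - (n + 1) = m by omega, show (n : ℕ) + m + 1 - 1 = n + m by omega,
    show (n : ℕ) + m + 1 + 1 = n + m + 2 by omega,
    show ((n + m + 1 : ℕ) : ℤ) + 1 - 2 * (n + 1 : ℕ) = m - n by push_cast; ring] at h
  rw [show (n : ℕ) + m - n = m by omega, show ((n + m : ℕ) : ℤ) - 2 * (n : ℕ) = m - n by
    push_cast; ring] at h2
  rw [show (n : ℕ) + m + 2 - (n + 1) = m + 1 by omega,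
    show ((n + m + 2 : ℕ) : ℤ) - 2 * (n + 1 : ℕ) = m - n by push_cast; ring]
  have b := binC_succ k n
  push_cast at h
  generalize C (invBin k n * invBin k m) = c
  linear_combination c * h + 3 * c * (k + 1 - (n : ℕ)) * h2
    - 3 * c * binC k m * chebV ((m : ℤ) - n) * b

lemma weight_second_order_entry {k : ℕ} (hk : 1 ≤ k) (n m : Fin (k + 1)) :
    chebD ((matB1 k * weightMat k) m n - (matB1 k * weightMat k) n m)
      = -2 * (1 - X ^ 2) * ((matB0 k n n - matB0 k m m) * weightPoly k n m) := by
  have hk0 : (k : ℂ[X]) ≠ 0 := by exact_mod_cast (by omega : k ≠ 0)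
  have hkC : (k : ℂ) ≠ 0 := by exact_mod_cast (by omega : k ≠ 0)
  refine mul_left_cancel₀ hk0 ?_
  have hB : ∀ i : Fin (k + 1), (k : ℂ[X]) * matB0 k i i
      = ((i : ℕ) - k : ℂ[X]) * ((i : ℕ) * k - k ^ 2 - 5 * k - 6 : ℂ[X]) := by
    intro i
    simp only [matB0, coeffB0, Matrix.map_apply, tridiag, Matrix.of_apply, if_true]
    rw [if_neg (by omega)]
    simp only [← C_eq_natCast, ← C_mul, ← C_ofNat, ← C_sub, ← C_pow]
    congr 1; rw [two_mul_spin, spin]; field_simp; ring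
  have h := chebSum_second_order k (n + m + 1) (n + 1) (by omega)
  -- The boundary multiple of `V_{m-n}` lacks the factor `m - n`, but `chebD` supplies it.
  have e : (k : ℂ[X]) * ((matB1 k * weightMat k) m n - (matB1 k * weightMat k) n m)
      = C (invBin k n * invBin k m) * (C ((m : ℕ) - (n : ℕ) : ℂ)
        * (-((2 * k + 3 : ℂ[X]) * chebSum k (n + m + 2) (n + 1))
        - 2 * (k + 3 : ℂ[X]) * ((X : ℂ[X]) * chebSum k (n + m + 1) (n + 1))
        - 3 * chebSum k (n + m) (n + 1))
        + C ((((n : ℕ) : ℂ) + 1) * ((k + 1).choose (n + 1) : ℕ) * ((2 * k + 3)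
          * ((k + 1).choose (m + 1) : ℕ) + 3 * ((k + 1).choose m : ℕ)))
          * chebV ((m : ℤ) - n)) := by
    have h2 := chebSum_succ k (n + m) n
    rw [show (n : ℕ) + m - n = m by omega, show ((n + m : ℕ) : ℤ) - 2 * (n : ℕ) = m - n by
      push_cast; ring] at h2
    rw [mul_sub, matB1_mul_weightMat hk, matB1_mul_weightMat hk,
      mul_comm (invBin k m), add_comm (m : ℕ) (n : ℕ),
      chebSum_reflect (show (m : ℕ) + 2 + (n + 1) = n + m + 2 + 1 by ring),
      chebSum_reflect (show (m : ℕ) + 1 + (n + 1) = n + m + 1 + 1 by ring),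
      chebSum_reflect (show (m : ℕ) + (n + 1) = n + m + 1 by ring),
      chebSum_succ k (n + m + 2) (n + 1), show (n : ℕ) + m + 2 - (n + 1) = m + 1 by omega,
      show ((n + m + 2 : ℕ) : ℤ) - 2 * (n + 1 : ℕ) = m - n by push_cast; ring]
    have b := binC_succ k n
    generalize C (invBin k n * invBin k m) = c
    simp only [C_mul, C_add, C_sub, C_eq_natCast, C_1, C_ofNat]
    rw [← binC, ← binC, ← binC]
    linear_combination 3 * c * (k + 1 - (n : ℕ)) * h2 - 3 * c * binC k m * chebV ((m : ℤ) - n) * b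
  rw [show (k : ℂ[X]) = C (k : ℂ) from rfl, ← chebD_C_mul, C_eq_natCast, e, chebD_C_mul,
    map_add, chebD_C_mul, chebD_C_mul, chebD_chebV, weightPoly]
  rw [show (n : ℕ) + m + 1 + 1 - (n + 1) = m + 1 by omega,
    show (n : ℕ) + m + 1 - (n + 1) = m by omega, show (n : ℕ) + m + 1 - 1 = n + m by omega,
    show (n : ℕ) + m + 1 + 1 = n + m + 2 by omega,
    show ((n + m + 1 : ℕ) : ℤ) + 1 - 2 * (n + 1 : ℕ) = m - n by push_cast; ring] at h
  have hn := hB n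
  have hm := hB m
  simp only [C_mul, C_add, C_sub, C_eq_natCast, C_1, C_ofNat]
  rw [← binC, ← binC, ← binC]
  push_cast at h ⊢
  generalize chebD (_ - _) = Q at *
  linear_combination C (invBin k n) * C (invBin k m) * ((m : ℕ) - (n : ℕ)) * h
    + 2 * (1 - X ^ 2) * C (invBin k n) * C (invBin k m) * chebSum k (n + m + 1) (n + 1) * (hn - hm)

/-! ### Integration against the scalar weight -/

variable {N : ℕ}

lemma continuous_weighted_eval (f : ℂ[X]) :
    Continuous fun x : ℝ => ((√(1 - x) * √(1 + x) : ℝ) : ℂ) * f.eval (x : ℂ) := by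
  have : Continuous fun x : ℝ => f.eval (x : ℂ) := f.continuous.comp Complex.continuous_ofReal
  fun_prop

/-- The functional `f ↦ ∫_{-1}^{1} √(1 - x) √(1 + x) f(x) dx` on polynomials. -/
def chebInt : ℂ[X] →ₗ[ℂ] ℂ where
  toFun f := ∫ x in (-1 : ℝ)..1, ((√(1 - x) * √(1 + x) : ℝ) : ℂ) * f.eval (x : ℂ)
  map_add' f g := by
    rw [← intervalIntegral.integral_add ((continuous_weighted_eval f).intervalIntegrable _ _)
      ((continuous_weighted_eval g).intervalIntegrable _ _)]
    simp only [eval_add, mul_add]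
  map_smul' c f := by
    simp only [eval_smul, smul_eq_mul, RingHom.id_apply]
    rw [← intervalIntegral.integral_const_mul]
    simp only [mul_left_comm]

lemma hasDerivAt_sqrt_mul_sqrt {x : ℝ} (hx : x ∈ Set.Ioo (-1 : ℝ) 1) :
    HasDerivAt (fun x : ℝ => √(1 - x) * √(1 + x)) (-x / (√(1 - x) * √(1 + x))) x := by
  have h1 : 0 < 1 - x := by linarith [hx.2]
  have h2 : 0 < 1 + x := by linarith [hx.1]
  have d1 := ((hasDerivAt_id x).const_sub 1).sqrt h1.ne'
  have d2 := ((hasDerivAt_id x).const_add 1).sqrt h2.ne'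
  have s1 := Real.sq_sqrt h1.le
  have s2 := Real.sq_sqrt h2.le
  refine (d1.mul d2).congr_deriv ?_
  have p1 := (Real.sqrt_pos.mpr h1).ne'
  have p2 := (Real.sqrt_pos.mpr h2).ne'
  simp only [id]
  field_simp
  rw [s1, s2]; ring

/-- The hypothesis says `(w f)' = w r` on the open interval, and `w f` is continuous and vanishes at
`±1`. -/
lemma chebInt_eq_zero {f r : ℂ[X]} (h : chebD f = (1 - X ^ 2) * r) : chebInt r = 0 := by
  have hle : (-1 : ℝ) ≤ 1 := by norm_num
  have hd : ∀ x ∈ Set.Ioo (-1 : ℝ) 1,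
      HasDerivAt (fun x : ℝ => ((√(1 - x) * √(1 + x) : ℝ) : ℂ) * f.eval (x : ℂ))
        (((√(1 - x) * √(1 + x) : ℝ) : ℂ) * r.eval (x : ℂ)) x := by
    intro x hx
    have d1 := (hasDerivAt_sqrt_mul_sqrt hx).ofReal_comp
    have d2 := (f.hasDerivAt (x : ℂ)).comp_ofReal
    refine (d1.mul d2).congr_deriv ?_
    have h1 : 0 < 1 - x := by linarith [hx.2]
    have h2 : 0 < 1 + x := by linarith [hx.1]
    have hw : √(1 - x) * √(1 + x) ≠ 0 :=
      mul_ne_zero (Real.sqrt_pos.mpr h1).ne' (Real.sqrt_pos.mpr h2).ne'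
    have hw2 : (√(1 - x) * √(1 + x)) ^ 2 = 1 - x ^ 2 := by
      rw [mul_pow, Real.sq_sqrt h1.le, Real.sq_sqrt h2.le]; ring
    generalize √(1 - x) * √(1 + x) = w at *
    have hwC : (w : ℂ) ≠ 0 := by exact_mod_cast hw
    have hw2C : (w : ℂ) ^ 2 = 1 - (x : ℂ) ^ 2 := by exact_mod_cast hw2
    have h3 := congrArg (eval (x : ℂ)) h
    simp only [chebD_apply, eval_sub, eval_mul, eval_one, eval_pow, eval_X] at h3
    push_cast
    field_simp
    rw [hw2C]
    linear_combination h3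
  have h0 := intervalIntegral.integral_eq_sub_of_hasDerivAt_of_le hle
    (continuous_weighted_eval f).continuousOn hd
    ((continuous_weighted_eval r).intervalIntegrable _ _)
  simpa [chebInt] using h0

/-! ### Adjoints and derivatives of polynomial matrices -/

/-- The matrix of polynomials `x ↦ M(x)^*` (`x` real). -/
def sharp (M : Matrix (Fin N) (Fin N) ℂ[X]) : Matrix (Fin N) (Fin N) ℂ[X] :=
  (M.map (mapRingHom (starRingEnd ℂ))).transpose

lemma sharp_add (A B : Matrix (Fin N) (Fin N) ℂ[X]) : sharp (A + B) = sharp A + sharp B := by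
  ext1 i j; simp [sharp]

lemma sharp_mul (A B : Matrix (Fin N) (Fin N) ℂ[X]) : sharp (A * B) = sharp B * sharp A := by
  rw [sharp, Matrix.map_mul, Matrix.transpose_mul]; rfl

lemma sharp_smul (f : ℂ[X]) (A : Matrix (Fin N) (Fin N) ℂ[X]) :
    sharp (f • A) = f.map (starRingEnd ℂ) • sharp A := by
  ext1 i j; simp [sharp]

lemma sharp_matDeriv (A : Matrix (Fin N) (Fin N) ℂ[X]) :
    sharp (matDeriv A) = matDeriv (sharp A) := by
  ext1 i j; simp [sharp, matDeriv_apply, derivative_map]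

lemma sharp_map_eval (A : Matrix (Fin N) (Fin N) ℂ[X]) (x : ℝ) :
    (sharp A).map (eval (x : ℂ)) = (A.map (eval (x : ℂ))).conjTranspose := by
  ext1 i j
  have := (A j i).eval_map_apply (starRingEnd ℂ) (x : ℂ)
  rw [Complex.conj_ofReal] at this
  simpa [sharp] using this

lemma matDeriv_mul (A B : Matrix (Fin N) (Fin N) ℂ[X]) :
    matDeriv (A * B) = matDeriv A * B + A * matDeriv B := by
  ext1 i j
  simp [matDeriv_apply, Matrix.mul_apply, Finset.sum_add_distrib]

lemma matDeriv_smul (f : ℂ[X]) (A : Matrix (Fin N) (Fin N) ℂ[X]) :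
    matDeriv (f • A) = derivative f • A + f • matDeriv A := by
  ext1 i j
  simp [matDeriv_apply]

/-- A matrix valued polynomial as a matrix of polynomials. -/
def toMat : MatPoly N ≃ₐ[ℂ] Matrix (Fin N) (Fin N) ℂ[X] := matPolyEquiv.symm

lemma toMat_derivative (P : MatPoly N) : toMat (derivative P) = matDeriv (toMat P) := by
  ext i j d
  rw [matDeriv_apply, coeff_derivative, toMat, matPolyEquiv_symm_apply_coeff,
    matPolyEquiv_symm_apply_coeff, coeff_derivative]
  have h : ((d : Mat N) + 1) = Matrix.diagonal fun _ => (d : ℂ) + 1 := by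
    rw [← Matrix.diagonal_add, Matrix.diagonal_one, ← Matrix.diagonal_natCast]
  rw [h, Matrix.mul_diagonal]

lemma evalAt_eq (P : MatPoly N) (x : ℝ) : evalAt P x = (toMat P).map (eval (x : ℂ)) :=
  (matPolyEquiv_symm_map_eval P (x : ℂ)).symm

lemma pairing_apply {k : ℕ} (P Q : MatPoly (k + 1)) (i j : Fin (k + 1)) :
    pairing (weight k) P Q i j
      = chebInt ((toMat P * weightMat k * sharp (toMat Q)) i j) := by
  rw [pairing, Matrix.of_apply]
  refine intervalIntegral.integral_congr fun x _ => ?_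
  have hW : weight k x = ((√(1 - x) * √(1 + x) : ℝ) : ℂ) • (weightMat k).map (eval (x : ℂ)) := by
    ext n m
    rw [weight_apply]; rfl
  change (evalAt P x * weight k x * (evalAt Q x).conjTranspose) i j = _
  rw [evalAt_eq, evalAt_eq, hW, ← sharp_map_eval, Matrix.mul_smul, Matrix.smul_mul,
    Matrix.smul_apply, smul_eq_mul]
  congr 1
  change _ = (((toMat P * weightMat k * sharp (toMat Q)).map (evalRingHom (x : ℂ))) i j)
  rw [Matrix.map_mul, Matrix.map_mul]; rfl

lemma act_opD {k : ℕ} (P : MatPoly (k + 1)) :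
    act P (opD k) = derivative (derivative P) * (X ^ 2 - 1) + derivative P * coeffB1 k
      + P * C (coeffB0 k) := by
  rw [act, opD, Finsupp.sum_add_index', Finsupp.sum_add_index', Finsupp.sum_single_index,
    Finsupp.sum_single_index, Finsupp.sum_single_index]
  · simp
  all_goals simp [mul_add]

lemma act_opE {k : ℕ} (P : MatPoly (k + 1)) :
    act P (opE k) = derivative P * coeffA1 k + P * C (coeffA0 k) := by
  rw [act, opE, Finsupp.sum_add_index', Finsupp.sum_single_index, Finsupp.sum_single_index]
  · simp
  all_goals simp [mul_add]

lemma toMat_X : toMat (X : MatPoly N) = (X : ℂ[X]) • (1 : Matrix (Fin N) (Fin N) ℂ[X]) := by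
  rw [toMat, matPolyEquiv_symm_X, ← Matrix.smul_one_eq_diagonal]

lemma toMat_C (A : Mat N) : toMat (C A) = A.map C := matPolyEquiv_symm_C A

lemma toMat_act_opD {k : ℕ} (P : MatPoly (k + 1)) :
    toMat (act P (opD k)) = (X ^ 2 - 1 : ℂ[X]) • matDeriv (matDeriv (toMat P))
      + matDeriv (toMat P) * matB1 k + toMat P * matB0 k := by
  rw [act_opD, map_add, map_add, map_mul, map_mul, map_mul, toMat_derivative, toMat_derivative,
    toMat_C, map_sub, map_pow, toMat_X, map_one, _root_.smul_pow, one_pow, show (X ^ 2 : ℂ[X]) • (1 : Matrix (Fin (k + 1)) (Fin (k + 1)) ℂ[X]) - 1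
      = (X ^ 2 - 1 : ℂ[X]) • 1 by rw [sub_smul, one_smul], mul_smul_comm,
    mul_one]
  rfl

lemma conj_spin (k : ℕ) : (starRingEnd ℂ) (spin k) = spin k := by simp [spin, map_ofNat]

lemma tridiag_map_conj {k : ℕ} {u d l : ℕ → ℂ} (hu : ∀ i, (starRingEnd ℂ) (u i) = u i)
    (hd : ∀ i, (starRingEnd ℂ) (d i) = d i) (hl : ∀ i, (starRingEnd ℂ) (l i) = l i)
    (i j : Fin (k + 1)) : (starRingEnd ℂ) (tridiag k u d l i j) = tridiag k u d l i j := by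
  simp only [tridiag, Matrix.of_apply]
  split_ifs <;> simp [*]

lemma sharp_matB1 (k : ℕ) : sharp (matB1 k) = (matB1 k).transpose := by
  ext1 i j
  simp only [sharp, Matrix.transpose_apply, Matrix.map_apply, matB1_apply, coe_mapRingHom,
    Polynomial.map_add, Polynomial.map_mul, map_C, map_X]
  rw [tridiag_map_conj, tridiag_map_conj] <;> simp [conj_spin, map_ofNat]

lemma matB0_eq_diagonal (k : ℕ) : matB0 k = Matrix.diagonal fun i => matB0 k i i := by
  ext1 i j
  rcases eq_or_ne i j with rfl | h
  · simp
  · rw [Matrix.diagonal_apply_ne _ h, matB0, coeffB0, Matrix.map_apply, tridiag, Matrix.of_apply]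
    have : (j : ℕ) ≠ i := fun h' => h (Fin.ext h'.symm)
    simp [this]

lemma sharp_matB0 (k : ℕ) : sharp (matB0 k) = matB0 k := by
  rw [matB0_eq_diagonal, sharp, Matrix.diagonal_map (by simp), Matrix.diagonal_transpose]
  congr 1
  ext1 i
  simp only [matB0, coeffB0, Matrix.map_apply, coe_mapRingHom, map_C]
  rw [tridiag_map_conj] <;> simp [conj_spin, map_ofNat]

/-! ### Green's identity and symmetry of `D` -/

lemma weight_first_order {k : ℕ} (hk : 1 ≤ k) :
    (2 : ℂ[X]) • ((3 * X : ℂ[X]) • weightMat k + (X ^ 2 - 1 : ℂ[X]) • matDeriv (weightMat k))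
      = matB1 k * weightMat k + weightMat k * (matB1 k).transpose := by
  have : weightMat k * (matB1 k).transpose = (matB1 k * weightMat k).transpose := by
    rw [Matrix.transpose_mul, weightMat_transpose]
  rw [this]
  ext1 n m
  exact weight_first_order_entry hk n m

lemma weight_second_order {k : ℕ} (hk : 1 ≤ k) :
    (1 - X ^ 2 : ℂ[X]) • matDeriv (weightMat k * (matB1 k).transpose - matB1 k * weightMat k)
      - (X : ℂ[X]) • (weightMat k * (matB1 k).transpose - matB1 k * weightMat k)
      = (-2 * (1 - X ^ 2) : ℂ[X]) • (matB0 k * weightMat k - weightMat k * matB0 k) := by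
  have : weightMat k * (matB1 k).transpose = (matB1 k * weightMat k).transpose := by
    rw [Matrix.transpose_mul, weightMat_transpose]
  rw [this, matB0_eq_diagonal]
  ext1 n m
  have h := weight_second_order_entry hk n m
  rw [chebD_apply] at h
  simp only [Matrix.sub_apply, Matrix.smul_apply, Matrix.diagonal_mul, Matrix.mul_diagonal,
    matDeriv_apply, Matrix.transpose_apply, smul_eq_mul] at h ⊢
  rw [h, weightMat, Matrix.of_apply]; ring

/-- Formal Lagrange identity for `Θ = 2(x² - 1)(p'Zq - pZq') - pHq`: the left side is `(1 - x²)Θ' -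
xΘ`, with derivatives as independent letters. The equation `h1` enters between `p'` and `q` and
between `p` and `q'`, and `h2` between `p` and `q`. -/
lemma green_identity {R A : Type*} [CommRing R] [Ring A] [Algebra R A] (x : R)
    (p p1 p2 q q1 q2 Z Z1 B Bt B0 H H1 : A)
    (hH : H = Z * Bt - B * Z)
    (h1 : (2 : R) • ((3 * x) • Z + (x ^ 2 - 1) • Z1) = B * Z + Z * Bt)
    (h2 : (1 - x ^ 2) • H1 - x • H = (-2 * (1 - x ^ 2)) • (B0 * Z - Z * B0)) :
    (1 - x ^ 2) • (((2 * (2 * x)) • (p1 * Z * q - p * Z * q1)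
          + (2 * (x ^ 2 - 1)) • (p2 * Z * q + p1 * Z1 * q + p1 * Z * q1
            - (p1 * Z * q1 + p * Z1 * q1 + p * Z * q2)))
          - (p1 * H * q + p * H1 * q + p * H * q1))
        - x • ((2 * (x ^ 2 - 1)) • (p1 * Z * q - p * Z * q1) - p * H * q)
      = (2 * (1 - x ^ 2)) • (((x ^ 2 - 1) • p2 + p1 * B + p * B0) * Z * q
        - p * Z * ((x ^ 2 - 1) • q2 + Bt * q1 + B0 * q)) := by
  subst hH
  have e1 := congrArg (fun M => p1 * M * q) h1
  have e2 := congrArg (fun M => p * M * q1) h1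
  have e3 := congrArg (fun M => p * M * q) h2
  simp only [mul_add, add_mul, mul_sub, sub_mul, smul_add, smul_sub, mul_smul_comm,
    smul_mul_assoc, mul_assoc] at e1 e2 e3 ⊢
  linear_combination (norm := module) (1 - x ^ 2) • e1 - (1 - x ^ 2) • e2 - e3

theorem pairing_act_opD {k : ℕ} (hk : 1 ≤ k) (P Q : MatPoly (k + 1)) :
    pairing (weight k) (act P (opD k)) Q = pairing (weight k) P (act Q (opD k)) := by
  ext1 i j
  rw [pairing_apply, pairing_apply, ← sub_eq_zero, ← map_sub, ← Matrix.sub_apply, toMat_act_opD,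
    toMat_act_opD, sharp_add, sharp_add, sharp_smul, sharp_mul, sharp_mul, sharp_matDeriv,
    sharp_matDeriv, sharp_matB1, sharp_matB0]
  have h := green_identity (X : ℂ[X]) (toMat P) (matDeriv (toMat P))
    (matDeriv (matDeriv (toMat P))) (sharp (toMat Q)) (matDeriv (sharp (toMat Q)))
    (matDeriv (matDeriv (sharp (toMat Q)))) (weightMat k) _ (matB1 k) _ (matB0 k) _ _ rfl
    (weight_first_order hk) (weight_second_order hk)
  set p := toMat P
  set q := sharp (toMat Q)
  set Z := weightMat k
  set H := Z * (matB1 k).transpose - matB1 k * Z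
  have hΘ : matDeriv ((2 * (X ^ 2 - 1) : ℂ[X]) • (matDeriv p * Z * q - p * Z * matDeriv q)
      - p * H * q)
      = (2 * (2 * X) : ℂ[X]) • (matDeriv p * Z * q - p * Z * matDeriv q)
        + (2 * (X ^ 2 - 1) : ℂ[X]) • (matDeriv (matDeriv p) * Z * q + matDeriv p * matDeriv Z * q
          + matDeriv p * Z * matDeriv q
          - (matDeriv p * Z * matDeriv q + p * matDeriv Z * matDeriv q
            + p * Z * matDeriv (matDeriv q)))
        - (matDeriv p * H * q + p * matDeriv H * q + p * H * matDeriv q) := by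
    have hd : derivative (2 * (X ^ 2 - 1) : ℂ[X]) = 2 * (2 * X) := by
      simp [derivative_mul, one_add_one_eq_two]
      rfl
    simp only [map_sub, matDeriv_smul, matDeriv_mul, hd, add_mul]
  rw [← hΘ] at h
  have h' := congrFun (congrFun h i) j
  have h2 : chebD (((2 * (X ^ 2 - 1) : ℂ[X]) • (matDeriv p * Z * q - p * Z * matDeriv q)
      - p * H * q) i j) = (1 - X ^ 2) * ((2 : ℂ) •
        ((((X ^ 2 - 1 : ℂ[X]) • matDeriv (matDeriv p) + matDeriv p * matB1 k + p * matB0 k) * Z * q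
        - p * Z * ((X ^ 2 - 1 : ℂ[X]) • matDeriv (matDeriv q) + (matB1 k).transpose * matDeriv q
          + matB0 k * q)) i j)) := by
    rw [chebD_apply, smul_eq_C_mul, ← mul_assoc, mul_comm (1 - X ^ 2) (C 2)]
    exact h'
  have h3 := chebInt_eq_zero h2
  rw [map_smul, smul_eq_mul, mul_eq_zero] at h3
  simpa using h3

/-! ### Action of `D` on coefficients -/

variable {k : ℕ}

lemma isAdmissible_opD (k : ℕ) : IsAdmissible (opD k) := by
  intro i
  have h1 : (coeffB1 k).degree ≤ (1 : ℕ) := by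
    unfold coeffB1; rw [add_comm (C _)]; exact degree_linear_le
  have h2 : (X ^ 2 - 1 : MatPoly (k + 1)).degree ≤ (2 : ℕ) := by
    refine (degree_sub_le _ _).trans (max_le (degree_X_pow_le 2) ?_)
    exact degree_one_le.trans (by norm_num)
  simp only [opD, Finsupp.add_apply, Finsupp.single_apply]
  rcases i with _ | _ | _ | i
  · simpa using degree_C_le
  · simpa using h1
  · simpa using h2
  · simp

lemma eigenvalueD_eq (k d : ℕ) : eigenvalueD k d = ((d : ℂ) * (d - 1)) • (1 : Mat (k + 1))
    + (d : ℂ) • tridiag k (fun _ => 0)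
        (fun i => -((2 * spin k + 3) * (i - 2 * spin k) / spin k)) (fun _ => 0)
    + coeffB0 k := by
  ext i j
  rcases eq_or_ne i j with rfl | h
  · simp [eigenvalueD, coeffB0, tridiag]; ring
  · have : (j : ℕ) ≠ i := fun h' => h (Fin.ext h'.symm)
    simp [eigenvalueD, coeffB0, tridiag, h, this]

lemma coeff_derivative_smul (Q : MatPoly (k + 1)) (n : ℕ) :
    (derivative Q).coeff n = ((n : ℂ) + 1) • Q.coeff (n + 1) := by
  rw [coeff_derivative, ← Nat.cast_one (R := Mat (k + 1)), ← Nat.cast_add, ← nsmul_eq_mul',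
    ← Nat.cast_smul_eq_nsmul ℂ]
  push_cast; rfl

lemma coeff_derivative_mul_linear (Q : MatPoly (k + 1)) (b b' : Mat (k + 1)) (d : ℕ) :
    (derivative Q * (C b + C b' * X)).coeff d
      = ((d : ℂ) + 1) • (Q.coeff (d + 1) * b) + (d : ℂ) • (Q.coeff d * b') := by
  rw [mul_add, ← mul_assoc, coeff_add, coeff_mul_C, coeff_derivative_smul, smul_mul_assoc]
  congr 1
  rcases d with _ | d
  · simp
  · rw [coeff_mul_X, coeff_mul_C, coeff_derivative_smul, smul_mul_assoc]
    push_cast; rfl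

lemma coeff_derivative_two_mul (Q : MatPoly (k + 1)) (d : ℕ) :
    (derivative (derivative Q) * (X ^ 2 - 1)).coeff d
      = ((d : ℂ) * (d - 1)) • Q.coeff d - ((d + 1 : ℂ) * (d + 2)) • Q.coeff (d + 2) := by
  have h : ∀ n, (derivative (derivative Q)).coeff n
      = ((n + 1 : ℂ) * (n + 2)) • Q.coeff (n + 2) := by
    intro n
    rw [coeff_derivative_smul, coeff_derivative_smul, smul_smul]
    push_cast; ring_nf
  rw [mul_sub, mul_one, coeff_sub, h d, coeff_mul_X_pow']
  congr 1
  split_ifs with h2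
  · obtain ⟨e, rfl⟩ : ∃ e, d = e + 2 := ⟨d - 2, by omega⟩
    rw [Nat.add_sub_cancel, h]
    push_cast; ring_nf
  · have : d = 0 ∨ d = 1 := by omega
    rcases this with rfl | rfl <;> simp

/-- `D` is triangular for the degree, and its diagonal part is right multiplication by `eigenvalueD
k d`. -/
lemma coeff_act_opD (P : MatPoly (k + 1)) (d : ℕ) :
    (act P (opD k)).coeff d = P.coeff d * eigenvalueD k d
      + (d + 1 : ℂ) • (P.coeff (d + 1)
        * tridiag k (fun i => (4 * spin k + 3) * (i - 2 * spin k) / (2 * spin k)) (fun _ => 0)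
          (fun i => 3 * (i : ℂ) / (2 * spin k)))
      - ((d + 1 : ℂ) * (d + 2)) • P.coeff (d + 2) := by
  rw [act_opD, coeff_add, coeff_add, coeff_mul_C, coeff_derivative_two_mul]
  unfold coeffB1
  rw [coeff_derivative_mul_linear, eigenvalueD_eq, mul_add (P.coeff d), mul_add (P.coeff d), mul_smul_comm, mul_smul_comm,
    mul_one]
  abel

lemma degree_act_opD_lt {P : MatPoly (k + 1)} {n : ℕ} (h : P.degree < n) :
    (act P (opD k)).degree < n := by
  rw [degree_lt_iff_coeff_zero] at h ⊢
  intro m hm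
  rw [coeff_act_opD, h m hm, h (m + 1) (by omega), h (m + 2) (by omega)]
  simp

/-! ### Sesquilinearity and nondegeneracy of the pairing -/

lemma pairing_C_mul_left (A : Mat (k + 1)) (P Q : MatPoly (k + 1)) :
    pairing (weight k) (C A * P) Q = A * pairing (weight k) P Q := by
  ext1 i j
  rw [pairing_apply, map_mul, toMat_C, mul_assoc, mul_assoc, Matrix.mul_apply, map_sum,
    Matrix.mul_apply]
  refine Finset.sum_congr rfl fun l _ => ?_
  rw [pairing_apply, Matrix.map_apply, ← smul_eq_C_mul, map_smul, smul_eq_mul, mul_assoc]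

lemma pairing_add_left (P P' Q : MatPoly (k + 1)) :
    pairing (weight k) (P + P') Q = pairing (weight k) P Q + pairing (weight k) P' Q := by
  ext1 i j
  rw [Matrix.add_apply, pairing_apply, pairing_apply, pairing_apply, map_add, add_mul, add_mul,
    Matrix.add_apply, map_add]

lemma pairing_add_right (P Q Q' : MatPoly (k + 1)) :
    pairing (weight k) P (Q + Q') = pairing (weight k) P Q + pairing (weight k) P Q' := by
  ext1 i j
  rw [Matrix.add_apply, pairing_apply, pairing_apply, pairing_apply, map_add, sharp_add, mul_add,
    Matrix.add_apply, map_add]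

lemma pairing_C_mul_right (A : Mat (k + 1)) (P Q : MatPoly (k + 1)) :
    pairing (weight k) P (C A * Q) = pairing (weight k) P Q * A.conjTranspose := by
  ext1 i j
  rw [pairing_apply, map_mul, toMat_C, sharp_mul, ← mul_assoc, Matrix.mul_apply, map_sum,
    Matrix.mul_apply]
  refine Finset.sum_congr rfl fun l _ => ?_
  rw [pairing_apply, mul_comm, sharp, Matrix.transpose_apply, Matrix.map_apply, Matrix.map_apply,
    coe_mapRingHom, map_C, ← smul_eq_C_mul, map_smul, smul_eq_mul, mul_comm]
  rfl

/-- Each diagonal entry integrates `w` times the squared norm of a row of `MZ`, a continuous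
nonnegative function; so that row vanishes on `(-1, 1)`, hence identically. -/
lemma mul_weightMat_eq_zero {M : Matrix (Fin (k + 1)) (Fin (k + 1)) ℂ[X]}
    (h : ∀ i, chebInt (((M * weightMat k) * sharp (M * weightMat k)) i i) = 0) :
    M * weightMat k = 0 := by
  set B := M * weightMat k
  ext1 i j
  refine Polynomial.eq_zero_of_infinite_isRoot _ ?_
  have hinf : ((fun x : ℝ => (x : ℂ)) '' Set.Ioo (-1 : ℝ) 1).Infinite :=
    (Set.Ioo_infinite (by norm_num)).image Complex.ofReal_injective.injOn
  refine hinf.mono ?_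
  rintro _ ⟨c, hc, rfl⟩
  by_contra hne
  let f : ℝ → ℝ := fun x =>
    √(1 - x) * √(1 + x) * ∑ l, Complex.normSq ((B i l).eval (x : ℂ))
  have hf : ∀ x : ℝ, ((f x : ℝ) : ℂ)
      = ((√(1 - x) * √(1 + x) : ℝ) : ℂ) * ((B * sharp B) i i).eval (x : ℂ) := by
    intro x
    simp only [f]
    rw [Complex.ofReal_mul, Complex.ofReal_sum, Matrix.mul_apply, eval_finsetSum]
    congr 1
    refine Finset.sum_congr rfl fun l _ => ?_
    have h2 := congrFun (congrFun (sharp_map_eval B x) l) i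
    rw [Matrix.map_apply] at h2
    rw [eval_mul, h2, Matrix.conjTranspose_apply, Matrix.map_apply, ← Complex.mul_conj]
    rfl
  have hcont : Continuous f := by
    have : ∀ l, Continuous fun x : ℝ => (B i l).eval (x : ℂ) := fun l =>
      (B i l).continuous.comp Complex.continuous_ofReal
    refine Continuous.mul (by fun_prop) (continuous_finsetSum _ fun l _ => ?_)
    exact Complex.continuous_normSq.comp (this l)
  have hpos : 0 < ∫ x in (-1 : ℝ)..1, f x := by
    refine intervalIntegral.integral_pos (by norm_num) hcont.continuousOn (fun x _ => ?_)
      ⟨c, Set.Ioo_subset_Icc_self hc, ?_⟩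
    · exact mul_nonneg (by positivity) (Finset.sum_nonneg fun l _ => Complex.normSq_nonneg _)
    · have h1 : 0 < 1 - c := by linarith [hc.2]
      have h2 : 0 < 1 + c := by linarith [hc.1]
      refine mul_pos (mul_pos (Real.sqrt_pos.mpr h1) (Real.sqrt_pos.mpr h2)) ?_
      refine Finset.sum_pos' (fun l _ => Complex.normSq_nonneg _) ⟨j, Finset.mem_univ _, ?_⟩
      exact Complex.normSq_pos.mpr hne
  have h0 : ((∫ x in (-1 : ℝ)..1, f x : ℝ) : ℂ) = 0 := by
    rw [← intervalIntegral.integral_ofReal, ← h i]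
    exact intervalIntegral.integral_congr fun x _ => hf x
  exact hpos.ne' (by exact_mod_cast h0)

lemma eq_zero_of_mul_weightMat_eq_zero {T : MatPoly (k + 1)} (h : toMat T * weightMat k = 0) :
    T = 0 := by
  set Z : MatPoly (k + 1) := toMat.symm (weightMat k)
  have hTZ : T * Z = 0 := by
    apply toMat.injective
    rw [map_mul, AlgEquiv.apply_symm_apply, h, map_zero]
  have hZ : ∀ d, k ≤ d → ∀ i j, Z.coeff d i j
      = if (i : ℕ) + j = k ∧ d = k then invBin k i * invBin k j * 2 ^ k else 0 := by
    intro d hd i j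
    rw [← coeff_weightPoly (by omega) hd]
    exact matPolyEquiv_coeff_apply (weightMat k) d i j
  have hZdeg : Z.natDegree ≤ k := by
    rw [natDegree_le_iff_coeff_eq_zero]
    intro d hd
    ext i j
    rw [hZ d hd.le, if_neg (by omega)]; rfl
  have hlead : T.leadingCoeff * Z.coeff k = 0 := by
    rw [leadingCoeff, ← coeff_mul_add_eq_of_natDegree_le le_rfl hZdeg, hTZ, coeff_zero]
  rw [← leadingCoeff_eq_zero]
  ext i j
  -- Column `k - j` of the antidiagonal top coefficient has its only nonzero entry in row `j`.
  have h1 := congrFun (congrFun hlead i) (Fin.rev j)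
  rw [Matrix.mul_apply, Finset.sum_eq_single j] at h1
  · rw [hZ k le_rfl, if_pos ⟨by rw [Fin.val_rev]; omega, rfl⟩] at h1
    have hn : ∀ n : Fin (k + 1), invBin k n ≠ 0 := fun n => by
      rw [invBin]
      exact inv_ne_zero (by exact_mod_cast (Nat.choose_pos (by omega)).ne')
    exact (mul_eq_zero.mp h1).resolve_right
      (mul_ne_zero (mul_ne_zero (hn _) (hn _)) (pow_ne_zero _ two_ne_zero))
  · intro l _ hl
    rw [hZ k le_rfl, if_neg, mul_zero]
    rintro ⟨h2, -⟩
    rw [Fin.val_rev] at h2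
    exact hl (Fin.ext (by omega))
  · simp

/-- The pairing is nondegenerate. -/
lemma eq_zero_of_pairing_eq_zero {T : MatPoly (k + 1)}
    (h : ∀ Q, pairing (weight k) T Q = 0) : T = 0 := by
  refine eq_zero_of_mul_weightMat_eq_zero (mul_weightMat_eq_zero fun i => ?_)
  have h1 := congrFun (congrFun (h (toMat.symm (toMat T * weightMat k))) i) i
  rwa [pairing_apply, AlgEquiv.apply_symm_apply] at h1

/-! ### Orthogonal polynomials as eigenfunctions -/

/-- Invertible leading coefficients allow the top term of `Q` to be removed by a left multiple of `R
n`, so `R 0, …, R (n-1)` span degrees below `n`. -/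
lemma orthogonalSeq_induction {W : ℝ → Mat (k + 1)} {R : ℕ → MatPoly (k + 1)}
    (hR : IsOrthogonalSeq W R) (φ : MatPoly (k + 1) → Prop) (h0 : φ 0)
    (hadd : ∀ P Q, φ P → φ Q → φ (P + Q)) (hmul : ∀ A P, φ P → φ (C A * P)) (n : ℕ)
    (hn : ∀ j < n, φ (R j)) : ∀ Q : MatPoly (k + 1), Q.degree < n → φ Q := by
  induction n with
  | zero =>
    intro Q hQ
    have : Q = 0 := by simpa using hQ
    rwa [this]
  | succ n ih =>
    intro Q hQ
    obtain ⟨u, hu⟩ := hR.isUnit_leadingCoeff n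
    have hc : (R n).coeff n = u := by
      rw [hu, leadingCoeff, natDegree_eq_of_degree_eq_some (hR.degree_eq n)]
    rw [degree_lt_iff_coeff_zero] at hQ
    have hR0 := (degree_lt_iff_coeff_zero (R n) (n + 1)).mp (by
      rw [hR.degree_eq n]; exact_mod_cast n.lt_succ_self)
    set c := Q.coeff n * (↑u⁻¹ : Mat (k + 1))
    have h1 : φ (Q - C c * R n) := by
      refine ih (fun j hj => hn j (by omega)) _ ?_
      rw [degree_lt_iff_coeff_zero]
      intro m hm
      rw [coeff_sub, coeff_C_mul]
      rcases hm.eq_or_lt with rfl | hm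
      · rw [hc, mul_assoc, Units.inv_mul, mul_one, sub_self]
      · rw [hQ m hm, hR0 m hm, mul_zero, sub_zero]
    have h2 := hadd _ _ h1 (hmul c _ (hn n (by omega)))
    rwa [sub_add_cancel] at h2

lemma act_opD_eq {R : ℕ → MatPoly (k + 1)} (hk : 1 ≤ k) (hR : IsOrthogonalSeq (weight k) R)
    {n : ℕ} {Γ : Mat (k + 1)}
    (hΓ : Γ * (R n).leadingCoeff = (R n).leadingCoeff * eigenvalueD k n) :
    act (R n) (opD k) = C Γ * R n := by
  have hlow : ∀ n : ℕ, ∀ Q : MatPoly (k + 1), Q.degree < n → pairing (weight k) (R n) Q = 0 := by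
    intro n
    refine orthogonalSeq_induction hR (fun Q => pairing (weight k) (R n) Q = 0) ?_ ?_ ?_ n ?_
    · simpa using pairing_C_mul_right 0 (R n) 0
    · intro P Q hP hQ; rw [pairing_add_right, hP, hQ, add_zero]
    · intro A P hP; rw [pairing_C_mul_right, hP, zero_mul]
    · intro j hj; exact hR.pairing_eq_zero n j (by omega)
  have hleft : ∀ (Q : MatPoly (k + 1)) (n : ℕ), (∀ j < n, pairing (weight k) (R j) Q = 0) →
      ∀ P : MatPoly (k + 1), P.degree < n → pairing (weight k) P Q = 0 := by
    intro Q n hn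
    refine orthogonalSeq_induction hR (fun P => pairing (weight k) P Q = 0) ?_ ?_ ?_ n hn
    · simpa using pairing_C_mul_left 0 0 Q
    · intro P P' hP hP'; rw [pairing_add_left, hP, hP', add_zero]
    · intro A P hP; rw [pairing_C_mul_left, hP, mul_zero]
  set T := act (R n) (opD k) + C (-Γ) * R n with hT
  have hTdeg : T.degree < n := by
    rw [degree_lt_iff_coeff_zero]
    have hR0 := (degree_lt_iff_coeff_zero (R n) (n + 1)).mp (by
      rw [hR.degree_eq n]; exact_mod_cast n.lt_succ_self)
    intro m hm
    rw [hT, coeff_add, coeff_C_mul, coeff_act_opD, hR0 (m + 1) (by omega), hR0 (m + 2) (by omega)]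
    rcases hm.eq_or_lt with rfl | hm
    · rw [leadingCoeff, natDegree_eq_of_degree_eq_some (hR.degree_eq n)] at hΓ
      rw [zero_mul, smul_zero, smul_zero, add_zero, sub_zero, ← hΓ, neg_mul, add_neg_cancel]
    · rw [hR0 m hm, zero_mul, zero_mul, smul_zero, smul_zero, mul_zero, add_zero, sub_zero,
        add_zero]
  have hTR : ∀ m, pairing (weight k) T (R m) = 0 := by
    intro m
    -- For `m < n`, symmetry moves `D` onto `R m`, whose degree stays below `n`; for `m ≥ n`, the
    -- degree of `T` is below `m`.
    rcases lt_or_ge m n with hm | hm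
    · rw [hT, pairing_add_left, pairing_C_mul_left, hR.pairing_eq_zero n m (by omega), mul_zero,
        add_zero, pairing_act_opD hk]
      refine hlow n _ (degree_act_opD_lt ?_)
      rw [hR.degree_eq]; exact_mod_cast hm
    · exact hleft _ n (fun j hj => hR.pairing_eq_zero j m (by omega)) T hTdeg
  have hT0 : T = 0 := by
    refine eq_zero_of_pairing_eq_zero fun Q => ?_
    refine orthogonalSeq_induction hR (fun Q => pairing (weight k) T Q = 0) ?_ ?_ ?_
      (Q.natDegree + 1) (fun j _ => hTR j) Q ?_
    · simpa using pairing_C_mul_right 0 T 0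
    · intro P Q hP hQ; rw [pairing_add_right, hP, hQ, add_zero]
    · intro A P hP; rw [pairing_C_mul_right, hP, zero_mul]
    · exact degree_le_natDegree.trans_lt (by exact_mod_cast Nat.lt_succ_self _)
  have h2 : C (-Γ) * R n + C Γ * R n = 0 := by
    rw [← add_mul, ← C_add, neg_add_cancel, C_0, zero_mul]
  exact (eq_neg_of_add_eq_zero_left hT0).trans (neg_eq_of_add_eq_zero_right h2)

theorem isSymmetric_opD (hk : 1 ≤ k) : IsSymmetric (weight k) (opD k) :=
  ⟨isAdmissible_opD k, pairing_act_opD hk⟩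

theorem memAlgebra_opD (hk : 1 ≤ k) : MemAlgebra (weight k) (opD k) := by
  refine ⟨isAdmissible_opD k, fun R hR => ?_⟩
  have : ∀ n, ∃ Γ : Mat (k + 1), act (R n) (opD k) = C Γ * R n := by
    intro n
    obtain ⟨u, hu⟩ := hR.isUnit_leadingCoeff n
    refine ⟨u * eigenvalueD k n * (↑u⁻¹ : Mat (k + 1)), act_opD_eq hk hR ?_⟩
    rw [← hu, mul_assoc, Units.inv_mul, mul_one]
  choose Γ hΓ using this
  exact ⟨Γ, hΓ⟩

theorem act_opD_monic (hk : 1 ≤ k) {P : ℕ → MatPoly (k + 1)}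
    (hP : IsMonicOrthogonalSeq (weight k) P) (n : ℕ) :
    act (P n) (opD k) = C (eigenvalueD k n) * P n := by
  refine act_opD_eq hk hP.toIsOrthogonalSeq ?_
  rw [(hP.monic n).leadingCoeff, mul_one, one_mul]

/-! ### Commutation of `D` and `E` -/

lemma tridiag_eq_diagonal (k : ℕ) (d : ℕ → ℂ) :
    tridiag k (fun _ => 0) d (fun _ => 0) = Matrix.diagonal fun i : Fin (k + 1) => d i := by
  ext i j
  rcases eq_or_ne i j with rfl | h
  · simp [tridiag]
  · have : (j : ℕ) ≠ i := fun h' => h (Fin.ext h'.symm)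
    simp [tridiag, h, this]

/-- The constant term of `A₁`. -/
def constA1 (k : ℕ) : Mat (k + 1) :=
  tridiag k (fun i => (2 * spin k - i) / (2 * spin k)) (fun _ => 0)
    (fun i => -((i : ℂ) / (2 * spin k)))

/-- The coefficient of `x` in `A₁`. -/
def linA1 (k : ℕ) : Mat (k + 1) :=
  tridiag k (fun _ => 0) (fun i => -((spin k - i) / spin k)) (fun _ => 0)

/-- The constant term of `B₁`. -/
def constB1 (k : ℕ) : Mat (k + 1) :=
  tridiag k (fun i => (4 * spin k + 3) * (i - 2 * spin k) / (2 * spin k)) (fun _ => 0)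
    (fun i => 3 * (i : ℂ) / (2 * spin k))

/-- The coefficient of `x` in `B₁`. -/
def linB1 (k : ℕ) : Mat (k + 1) :=
  tridiag k (fun _ => 0) (fun i => -((2 * spin k + 3) * (i - 2 * spin k) / spin k)) (fun _ => 0)

lemma coeffA1_eq (k : ℕ) : coeffA1 k = C (constA1 k) + C (linA1 k) * X := rfl

lemma coeffB1_eq (k : ℕ) : coeffB1 k = C (constB1 k) + C (linB1 k) * X := rfl

lemma commute_tridiag_diag (d d' : ℕ → ℂ) :
    tridiag k (fun _ => 0) d (fun _ => 0) * tridiag k (fun _ => 0) d' (fun _ => 0)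
      = tridiag k (fun _ => 0) d' (fun _ => 0) * tridiag k (fun _ => 0) d (fun _ => 0) := by
  simp only [tridiag_eq_diagonal, Matrix.diagonal_mul_diagonal, mul_comm]

/-- The coefficient of `x` in the `P''` relation; the `x²` coefficient only needs diagonal matrices
to commute. -/
lemma bracket_linear (hk : 1 ≤ k) :
    (2 : ℂ) • constA1 k + constB1 k * linA1 k + linB1 k * constA1 k
      = constA1 k * linB1 k + linA1 k * constB1 k := by
  have hs := spin_ne_zero hk
  rw [linA1, linB1, tridiag_eq_diagonal, tridiag_eq_diagonal]
  ext i j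
  simp only [Matrix.add_apply, Matrix.smul_apply, Matrix.diagonal_mul, Matrix.mul_diagonal,
    constA1, constB1, tridiag, Matrix.of_apply, smul_eq_mul]
  split_ifs with h1 h2 h3
  · rw [h1]; push_cast; field_simp; ring
  · ring
  · rw [h3]; push_cast; field_simp; ring
  · ring

/-- The constant term of the `P'` relation. -/
lemma bracket_zeroth (hk : 1 ≤ k) :
    linB1 k * constA1 k + coeffB0 k * constA1 k + constB1 k * coeffA0 k
      = linA1 k * constB1 k + coeffA0 k * constB1 k + constA1 k * coeffB0 k := by
  have hs := spin_ne_zero hk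
  rw [linA1, linB1, coeffA0, coeffB0, tridiag_eq_diagonal, tridiag_eq_diagonal,
    tridiag_eq_diagonal, tridiag_eq_diagonal]
  ext i j
  simp only [Matrix.add_apply, Matrix.diagonal_mul, Matrix.mul_diagonal,
    constA1, constB1, tridiag, Matrix.of_apply]
  split_ifs with h1 h2 h3
  · rw [h1]; push_cast; field_simp; ring
  · ring
  · rw [h3]; push_cast; field_simp; ring
  · ring

lemma tridiag_mul_tridiag_apply {u l u' l' : ℕ → ℂ} (hu : u k = 0) (hl : l 0 = 0)
    (i j : Fin (k + 1)) :
    (tridiag k u (fun _ => 0) l * tridiag k u' (fun _ => 0) l') i j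
      = u i * (if (j : ℕ) = i + 1 + 1 then u' (i + 1) else if (j : ℕ) = i + 1 then 0
          else if (i : ℕ) + 1 = j + 1 then l' (i + 1) else 0)
        + l i * (if (j : ℕ) = i - 1 + 1 then u' (i - 1) else if (j : ℕ) = i - 1 then 0
          else if (i : ℕ) - 1 = j + 1 then l' (i - 1) else 0) := by
  have h := sum_tridiag_mul (d := fun _ => 0) hu hl i (fun n => C (if (j : ℕ) = n + 1 then u' n
    else if (j : ℕ) = n then 0 else if n = j + 1 then l' n else 0))
  apply C_injective
  simp only [C_0, zero_mul, add_zero] at h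
  rw [C_add, C_mul, C_mul, ← h, Matrix.mul_apply, map_sum]
  refine Finset.sum_congr rfl fun n _ => ?_
  rw [← C_mul]; rfl

/-- The constant term of the `P''` relation, the only one with a product of two off-diagonal
matrices. -/
lemma bracket_const (hk : 1 ≤ k) :
    constB1 k * constA1 k = constA1 k * constB1 k - (2 : ℂ) • linA1 k := by
  have hs := spin_ne_zero hk
  rw [linA1, tridiag_eq_diagonal]
  ext i j
  rw [Matrix.sub_apply, constA1, constB1,
    tridiag_mul_tridiag_apply (by simp [two_mul_spin]) (by simp),
    tridiag_mul_tridiag_apply (by simp [two_mul_spin]) (by simp), Matrix.smul_apply,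
    Matrix.diagonal_apply, smul_eq_mul]
  simp only [Fin.ext_iff]
  generalize (i : ℕ) = i
  generalize (j : ℕ) = j
  -- Row `0` is separate because `i - 1` truncates there.
  rcases i with _ | i
  · split_ifs <;> first | omega | (push_cast; field_simp; ring)
  · simp only [Nat.add_sub_cancel]
    split_ifs <;> first | omega | (push_cast; field_simp; ring)

lemma linear_mul_linear {N : ℕ} (a a' b b' : Mat N) :
    (C b + C b' * X) * (C a + C a' * X)
      = C (b * a) + C (b * a' + b' * a) * X + C (b' * a') * X ^ 2 := by
  have h : ∀ p : MatPoly N, X * p = p * X := fun p => X_mul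
  simp only [C_mul, C_add, mul_add, add_mul, pow_two, mul_assoc]
  rw [h (C a), ← mul_assoc X (C a'), h (C a')]
  simp only [mul_assoc]
  abel

lemma opD_opE_commute_first (hk : 1 ≤ k) :
    2 * X * coeffA1 k + coeffB1 k * coeffA1 k
      = coeffA1 k * coeffB1 k + 2 * C (linA1 k) * (X ^ 2 - 1) := by
  have h : ∀ p : MatPoly (k + 1), X * p = p * X := fun p => X_mul
  have e1 : 2 * X * (C (constA1 k) + C (linA1 k) * X)
      = C ((2 : ℂ) • constA1 k) * X + C ((2 : ℂ) • linA1 k) * X ^ 2 := by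
    rw [two_smul, two_smul, C_add, C_add, mul_assoc, h, two_mul]
    simp only [add_mul, pow_two, mul_assoc]
    abel
  have e2 : 2 * C (linA1 k) * (X ^ 2 - 1)
      = C ((2 : ℂ) • linA1 k) * X ^ 2 - C ((2 : ℂ) • linA1 k) := by
    rw [two_smul, C_add, two_mul, mul_sub, mul_one]
  have h1 := bracket_linear hk
  rw [add_assoc] at h1
  have h2 : linB1 k * linA1 k = linA1 k * linB1 k := commute_tridiag_diag _ _
  rw [coeffA1_eq, coeffB1_eq, linear_mul_linear, linear_mul_linear, e1, e2, bracket_const hk, ← h1,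
    h2, C_sub, C_add (a := (2 : ℂ) • constA1 k), add_mul (C ((2 : ℂ) • constA1 k))]
  abel

lemma opD_opE_commute_zeroth (hk : 1 ≤ k) :
    C (linB1 k) * coeffA1 k + C (coeffB0 k) * coeffA1 k + coeffB1 k * C (coeffA0 k)
      = C (linA1 k) * coeffB1 k + C (coeffA0 k) * coeffB1 k + coeffA1 k * C (coeffB0 k) := by
  have h1 : linB1 k * linA1 k = linA1 k * linB1 k := commute_tridiag_diag _ _
  have h2 : coeffB0 k * linA1 k = linA1 k * coeffB0 k := commute_tridiag_diag _ _
  have h3 : linB1 k * coeffA0 k = coeffA0 k * linB1 k := commute_tridiag_diag _ _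
  have h4 := congrArg (C : Mat (k + 1) → MatPoly (k + 1)) (bracket_zeroth hk)
  have hr : ∀ a a' c : Mat (k + 1), (C a + C a' * X) * C c = C (a * c) + C (a' * c) * X := by
    intro a a' c
    rw [add_mul, mul_assoc, X_mul_C, C_mul, C_mul, mul_assoc]
  have hl : ∀ a a' c : Mat (k + 1), C c * (C a + C a' * X) = C (c * a) + C (c * a') * X := by
    intro a a' c
    rw [mul_add, ← mul_assoc, C_mul, C_mul]
  rw [coeffA1_eq, coeffB1_eq, hl, hl, hl, hl, hr, hr, h1, h2, h3]
  rw [C_add, C_add, C_add, C_add] at h4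
  linear_combination (norm := abel) h4

/-- The hypotheses are the coefficient relations at `P'''`, `P''` (in two pieces), `P'` and `P`;
lower-case `a1`, `b1`, `w1` stand for the derivatives of `A1`, `B1`, `w`. -/
lemma commute_identity {A : Type*} [Ring A] {p p1 p2 p3 w w1 A1 a1 A0 B1 b1 B0 : A}
    (h3 : w * A1 = A1 * w) (h2 : w1 * A1 + B1 * A1 = A1 * B1 + 2 * a1 * w) (h2' : w * A0 = A0 * w)
    (h1 : b1 * A1 + B0 * A1 + B1 * A0 = a1 * B1 + A0 * B1 + A1 * B0)
    (h0 : B0 * A0 = A0 * B0) :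
    (p3 * w + p2 * w1 + (p2 * B1 + p1 * b1) + p1 * B0) * A1 + (p2 * w + p1 * B1 + p * B0) * A0
      = (p3 * A1 + p2 * a1 + p2 * a1 + p2 * A0) * w + (p2 * A1 + p1 * a1 + p1 * A0) * B1
        + (p1 * A1 + p * A0) * B0 := by
  have e3 := congrArg (p3 * ·) h3
  have e2 := congrArg (p2 * ·) h2
  have e2' := congrArg (p2 * ·) h2'
  have e1 := congrArg (p1 * ·) h1
  have e0 := congrArg (p * ·) h0
  simp only [mul_add, add_mul, mul_assoc, two_mul] at e3 e2 e2' e1 e0 ⊢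
  linear_combination (norm := abel) e3 + e2 + e2' + e1 + e0

theorem opD_opE_commute (hk : 1 ≤ k) (P : MatPoly (k + 1)) :
    act (act P (opD k)) (opE k) = act (act P (opE k)) (opD k) := by
  have hX : ∀ p : MatPoly (k + 1), (X ^ 2 - 1) * p = p * (X ^ 2 - 1) := fun p => by
    rw [sub_mul, mul_sub, one_mul, mul_one, X_pow_mul]
  have c0 : C (coeffB0 k) * C (coeffA0 k) = C (coeffA0 k) * C (coeffB0 k) := by
    rw [← C_mul, ← C_mul, coeffB0, coeffA0, commute_tridiag_diag]
  have dA : derivative (coeffA1 k) = C (linA1 k) := by simp [coeffA1_eq]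
  have dB : derivative (coeffB1 k) = C (linB1 k) := by simp [coeffB1_eq]
  have dX : derivative (X ^ 2 - 1 : MatPoly (k + 1)) = 2 * X := by
    rw [derivative_sub, derivative_one, sub_zero, pow_two, derivative_mul, derivative_X, one_mul,
      mul_one, two_mul]
  have h := commute_identity (p := P) (p1 := derivative P) (p2 := derivative (derivative P))
    (p3 := derivative (derivative (derivative P))) (hX (coeffA1 k)) (opD_opE_commute_first hk)
    (hX (C (coeffA0 k))) (opD_opE_commute_zeroth hk) c0
  rw [act_opE, act_opD, act_opD, act_opE]
  simp only [derivative_add, derivative_mul, derivative_C, dA, dB, dX, mul_zero, add_zero]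
  exact h

end MVOP

end

theorem mainTheorem6 (k : ℕ) (hk : 1 ≤ k) :
    MVOP.IsSymmetric (MVOP.weight k) (MVOP.opD k) ∧
    MVOP.MemAlgebra (MVOP.weight k) (MVOP.opD k) ∧
    (∀ P : ℕ → MVOP.MatPoly (k + 1), MVOP.IsMonicOrthogonalSeq (MVOP.weight k) P →
      ∀ n : ℕ, MVOP.act (P n) (MVOP.opD k) = C (MVOP.eigenvalueD k n) * P n) ∧
    (∀ P : MVOP.MatPoly (k + 1),
      MVOP.act (MVOP.act P (MVOP.opD k)) (MVOP.opE k)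
        = MVOP.act (MVOP.act P (MVOP.opE k)) (MVOP.opD k)) :=
  ⟨MVOP.isSymmetric_opD hk, MVOP.memAlgebra_opD hk, fun _ hP => MVOP.act_opD_monic hk hP,
    MVOP.opD_opE_commute hk⟩
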